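/- **Setting.** Let $G=(V,E)$ be a finite simple bipartite graph with colour classes $F$ and $W$, with capacities $b(e)>0$ on the edges, quotas $q(v)>0$ on the vertices and, for each vertex $v$, a weak linear order $\ge_v$ on the set $E_v$ of edges incident to $v$; its equivalence classes are called ties. For $z:E_v\to\mathbb R_{\ge 0}$ with $z\le b$, put $|z|=\sum_{e\in E_v}z(e)$. If $|z|\ge q(v)$, the *critical tie* of $z$ is the tie $\pi$ such that the $z$-total of the strictly better ties is $<q(v)$ and becomes $\ge q(v)$ when $\pi$ is added. The choice function $C_v$ is: $C_v(z)=z$ if $|z|\le q(v)$; otherwise $C_v(z)$ equals $z$ on the ties better than the critical one, $0$ on the worse ones, and $\min(r,z)$ on the critical tie, where the cutting height $r$ is chosen so that $|C_v(z)|=q(v)$. Write $z\succeq_v z'$ if $C_v(z\vee z')=z$. For $x:E\to\mathbb R$ let $x_v=x|_{E_v}$. An assignment $x:E\to\mathbb R$ with $0\le x\le b$ and $C_v(x_v)=x_v$ for all $v$ is *stable* if no edge $e=fw$ is interesting for both $f$ and $w$; here $e$ is interesting for $v$ if some $z'\le b$ on $E_v$, obtained from $x_v$ by increasing only the value at $e$,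 satisfies $C_v(z')(e)>x(e)$. For stable $x,y$ write $x\succeq_W y$ if $x_w\succeq_w y_w$ for all $w\in W$; $x_{\min}$ and $x_{\max}$ denote the least and the greatest stable assignment for $\succeq_W$. **Active graph.** Fix a stable $x$. A vertex $v$ is *fully filled* if $|x_v|=q(v)$, and *deficit* otherwise. For a fully filled $v$, the *head* $H_v$ is the set of edges of the critical tie at which $x$ takes its maximum on that tie, and the *tail* $T_v$ consists of all edges in ties better than the critical one and of the edges of the critical tie outside $H_v$; for a deficit $v$, $H_v=\emptyset$ and $T_v=E_v$. For a fully filled $f\in F$, consider the ties of $f$ that contain an edge $fw$ with $x(fw)<b(fw)$ and $fw\in T_w$, and for which no tie better than or equal to it contains an edge $e$ with $x(e)<b(e)$ incident to a deficit vertex of $W$. In the best of these ties, $D_f$ is the set of edges $fw$ with $x(fw)<b(fw)$ and $fw\in T_w$; $D_f=\emptyset$ if there is no such tie. A set $V^0$ of fully filled vertices is grown as follows: start with each fully filled $w\in W$ for which $H_w$ contains an edge incident to a deficit vertex and each fully filled $f\in F$ with $D_f=\emptyset$; then repeatedly add each fully filled vertex whose set $D_f$ (resp. $H_w$) contains an edge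 incident to a vertex already in $V^0$. The fully filled vertices outside $V^0$ are *regular*; they form $F^+\subseteq F$ and $W^+\subseteq W$. The directed graph $\vec\Gamma(x)$ has the edges $(f,w)$ for $f\in F^+$, $fw\in D_f$, and $(w,f)$ for $w\in W^+$, $fw\in H_w$. Let $\mathcal L(x)$ be the set of strong components of $\vec\Gamma(x)$ with more than one vertex from which no other such component is reachable. **Rotations.** For $L\in\mathcal L(x)$ there is, up to a positive factor, a unique nonzero pair of functions $\phi:F^+\to\mathbb R_{\ge0}$, $\psi:W^+\to\mathbb R_{\ge 0}$ that vanishes outside the vertex set of $L$ and satisfies $|D_f|\phi_f=\sum(\psi_w: w\in W^+,\,fw\in H_w)$ for all $f\in F^+$ and $|H_w|\psi_w=\sum(\phi_f: f\in F^+,\,fw\in D_f)$ for all $w\in W^+$. The *rotation* $\rho_L\in\mathbb Z^E$ is the positive multiple, with coprime integer entries, of the vector equal to $\phi_f$ on the edges of $D_f$ ($f\in F^+$), to $-\psi_w$ on the edges of $H_w$ ($w\in W^+$) and to $0$ elsewhere. A weight $\lambda\ge 0$ is *admissible* for $\rho_L$ under $x$ if $x'=x+\lambda\rho_L$ satisfies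 $0\le x'\le b$ and for each $w\in W^+$ either $x'$ and $x$ have the same critical tie at $w$ and $H_w(x')\supseteq H_w(x)$, or $x'$ is zero on the critical tie of $x$ at $w$. **Routes.** A *route* is a sequence $T=(x_0,\dots,x_N)$ of stable assignments with $x_0=x_{\min}$, $x_N=x_{\max}$ and $x_i=x_{i-1}+\lambda_i\rho_i$, where $\rho_i$ is the rotation for $x_{i-1}$ associated with some $L_i\in\mathcal L(x_{i-1})$, the weight $\lambda_i>0$ is admissible for $\rho_i$ under $x_{i-1}$, and $\rho_1,\dots,\rho_N$ are pairwise different. Put $\Omega(T)=\{(\lambda_i,\rho_i): i=1,\dots,N\}$. **Proposition.** The set $\Omega(T)$ is the same for all routes $T$. Consequently there are a set $\mathcal R\subset\mathbb Z^E$ and a function $\tau$ on it such that, for every route $T$, the set of rotations used by $T$ is $\mathcal R$ and $\Omega(T)=\{(\tau(\rho),\rho):\rho\in\mathcal R\}$; moreover, whenever $\rho=\rho_i$ is applied in $T$, the number $\tau(\rho)$ is the maximal admissible weight for $\rho$ under $x_{i-1}$. -/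

import Mathlib

/-- A simple bipartite graph with colour classes `F` (firms) and `W` (workers) and edge set `E`;
the edge `e` connects `left e` and `right e`. -/
structure BipartiteGraph (F W E : Type*) where
  left : E → F
  right : E → W
  simple : ∀ e e' : E, left e = left e' → right e = right e' → e = e'

namespace BipartiteGraph

variable {F W E : Type*}

/-- The edge `e` is incident to the vertex `v`; the vertex set is `F ⊕ W`. -/
def Inc (G : BipartiteGraph F W E) (v : F ⊕ W) (e : E) : Prop :=
  v = Sum.inl (G.left e) ∨ v = Sum.inr (G.right e)

end BipartiteGraph

/-- An instance of the stable assignment problem of mixed type: a bipartite graph with positive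
capacities `b`, positive quotas `q`, and for each vertex `v` a weak linear order on the set of
edges incident to `v`: `geq v e e'` means that `e` is at least as good as `e'` for `v`.
(Values of `geq v` on edges not incident to `v` are never used.) -/
structure MixedProblem (F W E : Type*) extends BipartiteGraph F W E where
  b : E → ℝ
  q : F ⊕ W → ℝ
  b_pos : ∀ e, 0 < b e
  q_pos : ∀ v, 0 < q v
  geq : F ⊕ W → E → E → Prop
  geq_trans : ∀ v e₁ e₂ e₃, toBipartiteGraph.Inc v e₁ → toBipartiteGraph.Inc v e₂ →
    toBipartiteGraph.Inc v e₃ → geq v e₁ e₂ → geq v e₂ e₃ → geq v e₁ e₃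
  geq_total : ∀ v e₁ e₂, toBipartiteGraph.Inc v e₁ → toBipartiteGraph.Inc v e₂ →
    geq v e₁ e₂ ∨ geq v e₂ e₁

namespace MixedProblem

noncomputable section

open scoped Classical

variable {F W E : Type*} [Fintype F] [Fintype W] [Fintype E] (P : MixedProblem F W E)

/-- `e` is strictly better than `e'` for `v`. -/
def gt (v : F ⊕ W) (e e' : E) : Prop := P.geq v e e' ∧ ¬ P.geq v e' e

/-- The set `E_v` of edges incident to `v`. -/
def star (v : F ⊕ W) : Finset E := Finset.univ.filter fun e => P.Inc v e

/-- `|z_v|`, the total value of the nonnegative assignment `z` on `E_v`. -/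
def size (v : F ⊕ W) (z : E → ℝ) : ℝ := ∑ e ∈ P.star v, z e

/-! ### The mixed choice function

An assignment on `E_v` is represented by a function `z : E → ℝ` on all edges, of which only the
values on `E_v` matter. -/

/-- The critical tie of `z` at `v`: the tie `π^i` with
`z (π^1 ∪ ⋯ ∪ π^(i-1)) < q v ≤ z (π^1 ∪ ⋯ ∪ π^i)` (empty if `|z_v| < q v`). -/
def critTie (v : F ⊕ W) (z : E → ℝ) : Finset E :=
  (P.star v).filter fun e =>
    ∑ e' ∈ (P.star v).filter (fun e' => P.gt v e' e), z e' < P.q v ∧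
    P.q v ≤ ∑ e' ∈ (P.star v).filter (fun e' => P.geq v e' e), z e'

/-- The edges at `v` in ties better than the critical one. -/
def begEdges (v : F ⊕ W) (z : E → ℝ) : Finset E :=
  (P.star v).filter fun e => ∃ c ∈ P.critTie v z, P.gt v e c

/-- The cutting height in the critical tie. If `|z_v| = q v`, every large enough number satisfies
the defining equation; the least solution is then the maximum of `z` on the critical tie. -/
def cutHeight (v : F ⊕ W) (z : E → ℝ) : ℝ :=
  sInf {r : ℝ | 0 ≤ r ∧
    ∑ e ∈ P.begEdges v z, z e + ∑ e ∈ P.critTie v z, min r (z e) = P.q v}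

/-- The choice function `C_v` of mixed type. -/
def choice (v : F ⊕ W) (z : E → ℝ) (e : E) : ℝ :=
  if P.size v z ≤ P.q v then z e
  else if e ∈ P.begEdges v z then z e
  else if e ∈ P.critTie v z then min (P.cutHeight v z) (z e)
  else 0

/-- The revealed preference at `v`: `C_v (y ∨ z) = y` on `E_v`. -/
def PrefAt (v : F ⊕ W) (y z : E → ℝ) : Prop :=
  ∀ e ∈ P.star v, P.choice v (fun a => max (y a) (z a)) e = y e

/-! ### Stable assignments -/

/-- Fully stationary assignments: `0 ≤ x ≤ b` and `C_v (x_v) = x_v` for every vertex `v`. -/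
def FullyStationary (x : E → ℝ) : Prop :=
  (∀ e, 0 ≤ x e ∧ x e ≤ P.b e) ∧ ∀ v, ∀ e ∈ P.star v, P.choice v x e = x e

/-- `e` is interesting for `v` under `z`: raising `z` at `e` alone, to some value `t ≤ b e`, gives
an assignment `z'` with `C_v (z') (e) > z e`. -/
def Interesting (v : F ⊕ W) (z : E → ℝ) (e : E) : Prop :=
  ∃ t, z e < t ∧ t ≤ P.b e ∧ z e < P.choice v (Function.update z e t) e

/-- `e` is blocking for `x`: it is interesting for both of its ends. -/
def Blocking (x : E → ℝ) (e : E) : Prop :=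
  P.Interesting (Sum.inl (P.left e)) x e ∧ P.Interesting (Sum.inr (P.right e)) x e

def Stable (x : E → ℝ) : Prop := P.FullyStationary x ∧ ∀ e, ¬ P.Blocking x e

/-- `y` is at least as good as `x` for all workers. -/
def PrefW (y x : E → ℝ) : Prop := ∀ w : W, P.PrefAt (Sum.inr w) y x

/-- `x` is the minimal stable assignment for the preference order of `W`. -/
def IsXmin (x : E → ℝ) : Prop := P.Stable x ∧ ∀ y, P.Stable y → P.PrefW y x

/-- `x` is the maximal stable assignment for the preference order of `W`. -/
def IsXmax (x : E → ℝ) : Prop := P.Stable x ∧ ∀ y, P.Stable y → P.PrefW x y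

/-! ### Heads, tails, potential heads -/

def FullyFilled (x : E → ℝ) (v : F ⊕ W) : Prop := P.size v x = P.q v

/-- The head `H_v(x)` (empty for a deficit vertex). -/
def head (x : E → ℝ) (v : F ⊕ W) : Finset E :=
  if P.FullyFilled x v then (P.critTie v x).filter fun e => x e = P.cutHeight v x else ∅

/-- The tail `T_v(x)` (all of `E_v` for a deficit vertex). -/
def tail (x : E → ℝ) (v : F ⊕ W) : Finset E :=
  if P.FullyFilled x v then P.begEdges v x ∪ (P.critTie v x \ P.head x v) else P.star v

/-- The unsaturated edges at `f` lying in the tail of their other end: the union of all `D^i_f`. -/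
def candidates (x : E → ℝ) (f : F) : Finset E :=
  (P.star (Sum.inl f)).filter fun e => x e < P.b e ∧ e ∈ P.tail x (Sum.inr (P.right e))

/-- No tie better than or equal to that of `e` (at `f`) contains an unsaturated edge incident to a
deficit worker. -/
def NoDeficitAbove (x : E → ℝ) (f : F) (e : E) : Prop :=
  ∀ e' ∈ P.star (Sum.inl f), P.geq (Sum.inl f) e' e → x e' < P.b e' →
    P.FullyFilled x (Sum.inr (P.right e'))

/-- The potential head `D_f(x)`: the candidates in the best tie of `f` that contains a candidate
and satisfies the condition `NoDeficitAbove`. -/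
def potHead (x : E → ℝ) (f : F) : Finset E :=
  (P.candidates x f).filter fun e => P.NoDeficitAbove x f e ∧
    ∀ e' ∈ P.candidates x f, P.NoDeficitAbove x f e' → P.geq (Sum.inl f) e e'

/-! ### Cleaning procedure and active graph -/

/-- The vertices put into `V^0` by the cleaning procedure. -/
inductive Singular (x : E → ℝ) : F ⊕ W → Prop
  | deficit (e : E) : P.FullyFilled x (Sum.inr (P.right e)) →
      e ∈ P.head x (Sum.inr (P.right e)) → ¬ P.FullyFilled x (Sum.inl (P.left e)) →
      Singular x (Sum.inr (P.right e))
  | empty (f : F) : P.FullyFilled x (Sum.inl f) → P.potHead x f = ∅ →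
      Singular x (Sum.inl f)
  | stepF (e : E) : P.FullyFilled x (Sum.inl (P.left e)) → e ∈ P.potHead x (P.left e) →
      Singular x (Sum.inr (P.right e)) → Singular x (Sum.inl (P.left e))
  | stepW (e : E) : P.FullyFilled x (Sum.inr (P.right e)) →
      e ∈ P.head x (Sum.inr (P.right e)) →
      Singular x (Sum.inl (P.left e)) → Singular x (Sum.inr (P.right e))

/-- The regular vertices, i.e. the elements of `V^+ = F^+ ∪ W^+`. -/
def Regular (x : E → ℝ) (v : F ⊕ W) : Prop := P.FullyFilled x v ∧ ¬ P.Singular x v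

/-- `e` is active for `F`. -/
def ActiveF (x : E → ℝ) (e : E) : Prop :=
  P.Regular x (Sum.inl (P.left e)) ∧ e ∈ P.potHead x (P.left e)

/-- `e` is active for `W`. -/
def ActiveW (x : E → ℝ) (e : E) : Prop :=
  P.Regular x (Sum.inr (P.right e)) ∧ e ∈ P.head x (Sum.inr (P.right e))

/-- The directed edges of the active graph. -/
inductive Arc (x : E → ℝ) : F ⊕ W → F ⊕ W → Prop
  | toW (e : E) : P.ActiveF x e → Arc x (Sum.inl (P.left e)) (Sum.inr (P.right e))
  | toF (e : E) : P.ActiveW x e → Arc x (Sum.inr (P.right e)) (Sum.inl (P.left e))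

/-- There is a directed path from `u` to `v` in the active graph. -/
def Reach (x : E → ℝ) : F ⊕ W → F ⊕ W → Prop := Relation.ReflTransGen (P.Arc x)

/-- `L` is the vertex set of a strong component (with more than one vertex). -/
def IsStrongComponent (x : E → ℝ) (L : Set (F ⊕ W)) : Prop :=
  L.Nontrivial ∧ (∀ u ∈ L, ∀ v ∈ L, P.Reach x u v) ∧
    ∀ u ∈ L, ∀ v, P.Reach x u v → P.Reach x v u → v ∈ L

/-- `L` is the vertex set of a maximal strong component: no other strong component is reachable
from it. -/
def IsMaximalComponent (x : E → ℝ) (L : Set (F ⊕ W)) : Prop :=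
  P.IsStrongComponent x L ∧
    ∀ L', P.IsStrongComponent x L' → (∃ u ∈ L, ∃ v ∈ L', P.Reach x u v) → L' = L

/-! ### Rotations -/

/-- `(φ, ψ)`, supported by the regular vertices, solves the homogeneity and balance system of
total size `ε`. -/
structure IsBalanced (x : E → ℝ) (φ : F → ℝ) (ψ : W → ℝ) (ε : ℝ) : Prop where
  suppF : ∀ f, ¬ P.Regular x (Sum.inl f) → φ f = 0
  suppW : ∀ w, ¬ P.Regular x (Sum.inr w) → ψ w = 0
  balanceF : ∀ f, P.Regular x (Sum.inl f) →
    ((P.potHead x f).card : ℝ) * φ f -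
      ∑ e ∈ (P.star (Sum.inl f)).filter (fun e => P.ActiveW x e), ψ (P.right e) = 0
  balanceW : ∀ w, P.Regular x (Sum.inr w) →
    ((P.head x (Sum.inr w)).card : ℝ) * ψ w -
      ∑ e ∈ (P.star (Sum.inr w)).filter (fun e => P.ActiveF x e), φ (P.left e) = 0
  total : ∑ f ∈ Finset.univ.filter (fun f => P.Regular x (Sum.inl f)),
        ((P.potHead x f).card : ℝ) * φ f +
      ∑ w ∈ Finset.univ.filter (fun w => P.Regular x (Sum.inr w)),
        ((P.head x (Sum.inr w)).card : ℝ) * ψ w = ε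
  nonnegF : ∀ f, 0 ≤ φ f
  nonnegW : ∀ w, 0 ≤ ψ w

/-- The vector `Δ^{φ,ψ}` on the edges. -/
def delta (x : E → ℝ) (φ : F → ℝ) (ψ : W → ℝ) (e : E) : ℝ :=
  if P.ActiveF x e then φ (P.left e) else if P.ActiveW x e then -ψ (P.right e) else 0

/-- Normalized aligned `ℤ`-circulations. -/
structure IsNormalizedAlignedCirculation (ρ : E → ℤ) : Prop where
  ne_zero : ρ ≠ 0
  circulation : ∀ v, ∑ e ∈ P.star v, ρ e = 0
  alignedF : ∀ e e', P.left e = P.left e' → 0 < ρ e → 0 < ρ e' → ρ e = ρ e'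
  alignedW : ∀ e e', P.right e = P.right e' → ρ e < 0 → ρ e' < 0 → ρ e = ρ e'
  normalized : Finset.univ.gcd ρ = 1

/-- `ρ` is the rotation for `x` associated with the maximal strong component `L`: the normalized
aligned `ℤ`-circulation positively proportional to `Δ^{φ,ψ}`, where `(φ, ψ)` is a solution of the
system that vanishes outside `L`. -/
def IsRotation (x : E → ℝ) (L : Set (F ⊕ W)) (ρ : E → ℤ) : Prop :=
  P.IsMaximalComponent x L ∧ P.IsNormalizedAlignedCirculation ρ ∧
    ∃ φ ψ ε, 0 < ε ∧ P.IsBalanced x φ ψ ε ∧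
      (∀ f, Sum.inl f ∉ L → φ f = 0) ∧ (∀ w, Sum.inr w ∉ L → ψ w = 0) ∧
      ∃ c : ℝ, 0 < c ∧ ∀ e, (ρ e : ℝ) = c * P.delta x φ ψ e

/-- The function `x + c ρ`. -/
def shift (x : E → ℝ) (c : ℝ) (ρ : E → ℤ) : E → ℝ := fun e => x e + c * (ρ e : ℝ)

/-- `c` is an admissible weight for the rotation `ρ` under `x`. -/
def Admissible (x : E → ℝ) (ρ : E → ℤ) (c : ℝ) : Prop :=
  0 ≤ c ∧ (∀ e, 0 ≤ shift x c ρ e ∧ shift x c ρ e ≤ P.b e) ∧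
    ∀ w : W, P.Regular x (Sum.inr w) →
      (P.critTie (Sum.inr w) (shift x c ρ) = P.critTie (Sum.inr w) x ∧
        P.head x (Sum.inr w) ⊆ P.head (shift x c ρ) (Sum.inr w)) ∨
      ∀ e ∈ P.critTie (Sum.inr w) x, shift x c ρ e = 0

/-- `c` is the maximal admissible weight for `ρ` under `x`. -/
def IsMaxWeight (x : E → ℝ) (ρ : E → ℤ) (c : ℝ) : Prop :=
  IsGreatest {c' | P.Admissible x ρ c'} c

/-! ### Routes -/

/-- A sequence `x 0, …, x N` of stable assignments in which `x (i + 1)` is obtained from `x i` by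
the rotational shift of weight `weight i > 0` along the rotation `rot i`, associated with the
maximal strong component `comp i` of the active graph of `x i`. -/
structure ShiftSequence where
  N : ℕ
  x : Fin (N + 1) → E → ℝ
  comp : Fin N → Set (F ⊕ W)
  rot : Fin N → E → ℤ
  weight : Fin N → ℝ
  stable : ∀ i, P.Stable (x i)
  isRotation : ∀ i, P.IsRotation (x i.castSucc) (comp i) (rot i)
  weight_pos : ∀ i, 0 < weight i
  admissible : ∀ i, P.Admissible (x i.castSucc) (rot i) (weight i)
  step : ∀ i, x i.succ = shift (x i.castSucc) (weight i) (rot i)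

namespace ShiftSequence

variable {P}

/-- All rotations used are different. -/
def NonExpensive (T : P.ShiftSequence) : Prop := Function.Injective T.rot

/-- A (complete) route: a non-expensive sequence from `xmin` to `xmax`. -/
def IsRoute (T : P.ShiftSequence) : Prop :=
  T.NonExpensive ∧ P.IsXmin (T.x 0) ∧ P.IsXmax (T.x (Fin.last T.N))

/-- The set `R(T)` of rotations used by `T`. -/
def rotations (T : P.ShiftSequence) : Set (E → ℤ) := Set.range T.rot

/-- The set `Ω(T)` of pairs (weight, rotation) used by `T`. -/
def pairs (T : P.ShiftSequence) : Set (ℝ × (E → ℤ)) :=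
  Set.range fun i => (T.weight i, T.rot i)

end ShiftSequence

end

end MixedProblem

/-! Maximal strong components are pairwise disjoint sinks of the active graph, and a rotation is
supported by edges with both ends in its component. A shift along one component therefore changes no
value at the vertices of another. It could still affect potential heads there through workers
outside that component, but tails of workers only shrink (`IsRotation.tail_shift_subset`), so no new
candidates appear. Hence the other rotation and its admissible weights survive
(`IsRotation.persists_of_ne`). A rotation applied with less than some admissible weight also
survives, with the remainder admissible (`IsRotation.persists_of_lt`). At the greatest stable
assignment no rotation has a positive admissible weight (`IsRotation.not_isXmax`), so on every path
leading there an applicable rotation must eventually be used (`Path.exists_mem`).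

In a route the rotations are distinct, so none can be left over for later use, and every weight is
maximal. The rest is a confluence argument: shifts commute, an applicable rotation can be moved to
the front of any path with maximal weights (`MaxPath.exchange`), and by induction two such paths
with the same ends are permutations of each other (`MaxPath.perm`). The least and the greatest
stable assignment are unique, so all routes have the same ends. -/

namespace MixedProblem

open scoped Classical

noncomputable section

/-! ### Local theory at one vertex: choice, tails, stability, preferences. -/

section

variable {F W E : Type*} [Fintype E] (P : MixedProblem F W E)

/-! ### Ranks of edges -/

lemma mem_star {v : F ⊕ W} {e : E} : e ∈ P.star v ↔ P.Inc v e := by simp [star]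

lemma mem_star_left (e : E) : e ∈ P.star (Sum.inl (P.left e)) := by
  simp [star, BipartiteGraph.Inc]

lemma mem_star_right (e : E) : e ∈ P.star (Sum.inr (P.right e)) := by
  simp [star, BipartiteGraph.Inc]

lemma mem_star_inl {f : F} {e : E} : e ∈ P.star (Sum.inl f) ↔ P.left e = f := by
  simp [star, BipartiteGraph.Inc, eq_comm]

lemma mem_star_inr {w : W} {e : E} : e ∈ P.star (Sum.inr w) ↔ P.right e = w := by
  simp [star, BipartiteGraph.Inc, eq_comm]

/-- The rank of an edge at `v`: a numerical representation of the weak order at `v`. -/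
def rank (v : F ⊕ W) (e : E) : ℕ := ((P.star v).filter fun e' => P.geq v e e').card

lemma rank_le_iff {v : F ⊕ W} {e e' : E} (he : e ∈ P.star v) (he' : e' ∈ P.star v) :
    P.rank v e' ≤ P.rank v e ↔ P.geq v e e' := by
  rw [mem_star] at he he'
  constructor
  · intro h
    by_contra hn
    have h' : P.geq v e' e := (P.geq_total v e e' he he').resolve_left hn
    refine absurd h (not_le.2 (Finset.card_lt_card ?_))
    rw [Finset.ssubset_iff_of_subset]
    · refine ⟨e', ?_, ?_⟩
      · simpa [mem_star, he'] using (P.geq_total v e' e' he' he')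
      · simp [hn]
    · intro a ha
      simp only [Finset.mem_filter, mem_star] at ha ⊢
      exact ⟨ha.1, P.geq_trans v _ _ _ he' he ha.1 h' ha.2⟩
  · intro h
    refine Finset.card_le_card fun a ha => ?_
    simp only [Finset.mem_filter, mem_star] at ha ⊢
    exact ⟨ha.1, P.geq_trans v _ _ _ he he' ha.1 h ha.2⟩

lemma rank_lt_iff {v : F ⊕ W} {e e' : E} (he : e ∈ P.star v) (he' : e' ∈ P.star v) :
    P.rank v e' < P.rank v e ↔ P.gt v e e' := by
  rw [gt, ← P.rank_le_iff he he', ← P.rank_le_iff he' he]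
  omega

/-- The total value of `z` on the edges at `v` of rank at least `n`. -/
def upper (v : F ⊕ W) (z : E → ℝ) (n : ℕ) : ℝ :=
  ∑ e ∈ (P.star v).filter (fun e => n ≤ P.rank v e), z e

variable {P} {v : F ⊕ W} {x y z : E → ℝ} {n : ℕ}

lemma upper_zero : P.upper v z 0 = P.size v z := by simp [upper, size]

lemma upper_anti (hz : ∀ e ∈ P.star v, 0 ≤ z e) {m n : ℕ} (h : m ≤ n) :
    P.upper v z n ≤ P.upper v z m := by
  refine Finset.sum_le_sum_of_subset_of_nonneg (fun e he => ?_) fun e he _ => ?_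
  · simp only [Finset.mem_filter] at he ⊢
    exact ⟨he.1, h.trans he.2⟩
  · exact hz e (Finset.mem_filter.1 he).1

lemma upper_eq_add : P.upper v z n =
    P.upper v z (n + 1) + ∑ e ∈ (P.star v).filter (fun e => P.rank v e = n), z e := by
  simp only [upper, Finset.sum_filter, ← Finset.sum_add_distrib]
  refine Finset.sum_congr rfl fun e _ => ?_
  rcases lt_trichotomy n (P.rank v e) with h | h | h
  · simp [h.le, Nat.succ_le_of_lt h, h.ne']
  · simp [← h]
  · simp [h.not_ge, h.ne, (Nat.lt_succ_of_lt h).not_ge]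

lemma size_eq_add : P.size v z =
    P.upper v z n + ∑ e ∈ (P.star v).filter (fun e => P.rank v e < n), z e := by
  simp only [upper, size]
  rw [← Finset.sum_filter_add_sum_filter_not (P.star v) (fun e => n ≤ P.rank v e)]
  simp only [not_le]

lemma upper_update {e : E} (he : e ∈ P.star v) (t : ℝ) (n : ℕ) :
    P.upper v (Function.update x e t) n =
      P.upper v x n + if n ≤ P.rank v e then t - x e else 0 := by
  have : ∀ a, Function.update x e t a = x a + if a = e then t - x e else 0 := by
    intro a
    by_cases h : a = e
    · subst h; simp
    · simp [h]
  simp only [upper, this, Finset.sum_add_distrib]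
  congr 1
  rw [Finset.sum_ite_eq']
  simp [he]

lemma upper_congr (h : ∀ e ∈ P.star v, n ≤ P.rank v e → x e = y e) :
    P.upper v x n = P.upper v y n :=
  Finset.sum_congr rfl fun e he => h e (Finset.mem_filter.1 he).1 (Finset.mem_filter.1 he).2

/-! ### The critical tie and the cutting height -/

lemma mem_critTie {e : E} : e ∈ P.critTie v z ↔ e ∈ P.star v ∧
    P.upper v z (P.rank v e + 1) < P.q v ∧ P.q v ≤ P.upper v z (P.rank v e) := by
  simp only [critTie, Finset.mem_filter, upper]
  refine and_congr_right fun he => ?_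
  have h1 : (P.star v).filter (fun e' => P.gt v e' e) =
      (P.star v).filter (fun e' => P.rank v e + 1 ≤ P.rank v e') :=
    Finset.filter_congr fun a ha => by rw [← P.rank_lt_iff ha he, Nat.succ_le_iff]
  have h2 : (P.star v).filter (fun e' => P.geq v e' e) =
      (P.star v).filter (fun e' => P.rank v e ≤ P.rank v e') :=
    Finset.filter_congr fun a ha => by rw [← P.rank_le_iff ha he]
  rw [h1, h2]

/-- `n` is the rank of the critical tie of `z` at `v`. -/
structure IsCritRank (P : MixedProblem F W E) (v : F ⊕ W) (z : E → ℝ) (n : ℕ) : Prop where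
  nonneg : ∀ e ∈ P.star v, 0 ≤ z e
  lt : P.upper v z (n + 1) < P.q v
  le : P.q v ≤ P.upper v z n

lemma exists_isCritRank (hz : ∀ e ∈ P.star v, 0 ≤ z e) (h : P.q v ≤ P.size v z) :
    ∃ n, P.IsCritRank v z n := by
  have hex : ∃ n, P.upper v z (n + 1) < P.q v := by
    refine ⟨(P.star v).sup (P.rank v), ?_⟩
    have : (P.star v).filter (fun e => (P.star v).sup (P.rank v) + 1 ≤ P.rank v e) = ∅ := by
      rw [Finset.filter_eq_empty_iff]
      intro e he
      have := Finset.le_sup (f := P.rank v) he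
      omega
    rw [upper, this]
    simpa using P.q_pos v
  -- Minimality of this `n` gives the lower bound at `n`, except for `n = 0`, where `upper` is the
  -- full size.
  refine ⟨Nat.find hex, hz, Nat.find_spec hex, ?_⟩
  rcases Nat.eq_zero_or_pos (Nat.find hex) with h0 | h0
  · rw [h0, upper_zero]; exact h
  · have := Nat.find_min hex (Nat.sub_lt h0 one_pos)
    rwa [not_lt, show Nat.find hex - 1 + 1 = Nat.find hex from Nat.sub_add_cancel h0] at this

namespace IsCritRank

lemma unique {m : ℕ} (hn : P.IsCritRank v z n) (hm : P.IsCritRank v z m) : n = m := by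
  by_contra hne
  rcases lt_or_gt_of_ne hne with h | h
  · exact absurd ((hm.le.trans (upper_anti hn.nonneg h)).trans_lt hn.lt) (lt_irrefl _)
  · exact absurd ((hn.le.trans (upper_anti hn.nonneg h)).trans_lt hm.lt) (lt_irrefl _)

lemma mem_critTie (h : P.IsCritRank v z n) {e : E} :
    e ∈ P.critTie v z ↔ e ∈ P.star v ∧ P.rank v e = n := by
  rw [MixedProblem.mem_critTie]
  refine and_congr_right fun _ => ⟨fun h' => unique ⟨h.nonneg, h'.1, h'.2⟩ h, ?_⟩
  rintro rfl
  exact ⟨h.lt, h.le⟩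

lemma critTie_eq (h : P.IsCritRank v z n) :
    P.critTie v z = (P.star v).filter (fun e => P.rank v e = n) := by
  ext e; rw [h.mem_critTie, Finset.mem_filter]

lemma sum_tie_pos (h : P.IsCritRank v z n) :
    0 < ∑ e ∈ (P.star v).filter (fun e => P.rank v e = n), z e := by
  have := h.lt
  have := h.le
  rw [upper_eq_add] at this
  linarith

lemma nonempty (h : P.IsCritRank v z n) : ∃ e ∈ P.star v, P.rank v e = n := by
  obtain ⟨e, he⟩ := Finset.nonempty_of_sum_ne_zero h.sum_tie_pos.ne'
  exact ⟨e, Finset.mem_filter.1 he⟩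

lemma mem_begEdges (h : P.IsCritRank v z n) {e : E} :
    e ∈ P.begEdges v z ↔ e ∈ P.star v ∧ n < P.rank v e := by
  simp only [begEdges, Finset.mem_filter]
  refine and_congr_right fun he => ⟨?_, fun hlt => ?_⟩
  · rintro ⟨c, hc, hgt⟩
    rw [h.mem_critTie] at hc
    rw [← hc.2]
    exact (P.rank_lt_iff he hc.1).2 hgt
  · obtain ⟨c, hc, hcn⟩ := h.nonempty
    exact ⟨c, h.mem_critTie.2 ⟨hc, hcn⟩, (P.rank_lt_iff he hc).1 (hcn ▸ hlt)⟩

lemma sum_begEdges (h : P.IsCritRank v z n) (y : E → ℝ) :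
    ∑ e ∈ P.begEdges v z, y e = P.upper v y (n + 1) := by
  refine Finset.sum_congr ?_ fun _ _ => rfl
  ext e; rw [h.mem_begEdges, Finset.mem_filter, Nat.succ_le_iff]

/-- The left side is continuous in the height, at most the quota at `0` and at least the quota at
the total of `z`. The solution set is thus closed and nonempty, and the infimum defining `cutHeight`
is attained. -/
lemma cut_spec (h : P.IsCritRank v z n) : 0 ≤ P.cutHeight v z ∧
    P.upper v z (n + 1) +
      ∑ e ∈ (P.star v).filter (fun e => P.rank v e = n), min (P.cutHeight v z) (z e) = P.q v := by
  have hcont : Continuous fun r : ℝ => P.upper v z (n + 1) +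
      ∑ e ∈ (P.star v).filter (fun e => P.rank v e = n), min r (z e) := by fun_prop
  have key : P.cutHeight v z ∈ {r : ℝ | 0 ≤ r ∧
      P.upper v z (n + 1) +
        ∑ e ∈ (P.star v).filter (fun e => P.rank v e = n), min r (z e) = P.q v} := by
    rw [cutHeight, h.critTie_eq, h.sum_begEdges]
    refine IsClosed.csInf_mem ?_ ?_ ⟨0, fun r hr => hr.1⟩
    · exact isClosed_Ici.inter (isClosed_eq hcont continuous_const)
    · have hM : ∀ e ∈ P.star v, z e ≤ ∑ e ∈ P.star v, z e :=
        fun e he => Finset.single_le_sum h.nonneg he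
      have h0 : 0 ≤ ∑ e ∈ P.star v, z e := Finset.sum_nonneg h.nonneg
      have hlow : P.upper v z (n + 1) +
          ∑ e ∈ (P.star v).filter (fun e => P.rank v e = n), min 0 (z e) ≤ P.q v := by
        refine le_trans (le_of_eq (add_eq_left.2 ?_)) h.lt.le
        exact Finset.sum_eq_zero fun e he => min_eq_left (h.nonneg e (Finset.mem_filter.1 he).1)
      have hupp : P.q v ≤ P.upper v z (n + 1) +
          ∑ e ∈ (P.star v).filter (fun e => P.rank v e = n), min (∑ e ∈ P.star v, z e) (z e) := by
        refine h.le.trans (le_of_eq ?_)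
        rw [upper_eq_add, add_right_inj]
        exact Finset.sum_congr rfl fun e he =>
          (min_eq_right (hM e (Finset.mem_filter.1 he).1)).symm
      obtain ⟨r, hr, hrq⟩ := intermediate_value_Icc h0 hcont.continuousOn ⟨hlow, hupp⟩
      exact ⟨r, hr.1, hrq⟩
  exact key

lemma cut_le (h : P.IsCritRank v z n) {r : ℝ} (hr : 0 ≤ r)
    (hq : P.upper v z (n + 1) +
      ∑ e ∈ (P.star v).filter (fun e => P.rank v e = n), min r (z e) = P.q v) :
    P.cutHeight v z ≤ r := by
  rw [cutHeight, h.critTie_eq, h.sum_begEdges]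
  exact csInf_le ⟨0, fun r hr => hr.1⟩ ⟨hr, hq⟩

lemma choice_of_size_gt (h : P.IsCritRank v z n) (hs : P.q v < P.size v z) {e : E}
    (he : e ∈ P.star v) : P.choice v z e =
      if n < P.rank v e then z e else if P.rank v e = n then min (P.cutHeight v z) (z e) else 0 := by
  simp only [choice, hs.not_ge, h.mem_begEdges, h.mem_critTie, he, true_and, if_false]

lemma sum_choice (h : P.IsCritRank v z n) (hs : P.q v < P.size v z) :
    ∑ e ∈ P.star v, P.choice v z e = P.q v := by
  rw [← h.cut_spec.2, Finset.sum_congr rfl fun e he => h.choice_of_size_gt hs he, upper]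
  simp only [Finset.sum_filter, ← Finset.sum_add_distrib, Nat.succ_le_iff]
  refine Finset.sum_congr rfl fun e _ => ?_
  split_ifs <;> first | omega | simp

end IsCritRank

lemma choice_eq_self (h : P.size v z ≤ P.q v) (e : E) : P.choice v z e = z e := by
  simp [choice, h]

lemma size_le_of_choice_eq (hz : ∀ e ∈ P.star v, 0 ≤ z e)
    (h : ∀ e ∈ P.star v, P.choice v z e = z e) : P.size v z ≤ P.q v := by
  by_contra! hs
  obtain ⟨n, hn⟩ := exists_isCritRank hz hs.le
  have := hn.sum_choice hs
  rw [Finset.sum_congr rfl h] at this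
  exact hs.ne' this

/-! ### Fully filled vertices -/

/-- `v` is fully filled under `z ≥ 0`, with critical tie of rank `n`. -/
structure IsFilledRank (P : MixedProblem F W E) (v : F ⊕ W) (z : E → ℝ) (n : ℕ) : Prop
    extends P.IsCritRank v z n where
  filled : P.FullyFilled z v

lemma exists_isFilledRank (hz : ∀ e ∈ P.star v, 0 ≤ z e) (h : P.FullyFilled z v) :
    ∃ n, P.IsFilledRank v z n :=
  (exists_isCritRank hz (le_of_eq h.symm)).imp fun _ hn => ⟨hn, h⟩

namespace IsFilledRank

/-- The ties down to the critical one already exhaust the quota, which is the whole size. -/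
lemma sum_below (h : P.IsFilledRank v z n) :
    ∑ e ∈ (P.star v).filter (fun e => P.rank v e < n), z e ≤ 0 := by
  have := h.filled
  have := h.le
  rw [FullyFilled, size_eq_add (n := n)] at *
  linarith

lemma eq_zero (h : P.IsFilledRank v z n) {e : E} (he : e ∈ P.star v) (hr : P.rank v e < n) :
    z e = 0 := by
  have h0 : ∀ a ∈ (P.star v).filter (fun e => P.rank v e < n), 0 ≤ z a :=
    fun a ha => h.nonneg a (Finset.mem_filter.1 ha).1
  exact (Finset.sum_eq_zero_iff_of_nonneg h0).1 (le_antisymm h.sum_below (Finset.sum_nonneg h0)) e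
    (Finset.mem_filter.2 ⟨he, hr⟩)

lemma upper_eq (h : P.IsFilledRank v z n) : P.upper v z n = P.q v := by
  have h1 := h.filled
  rw [FullyFilled, size_eq_add (n := n),
    Finset.sum_eq_zero fun e he => h.eq_zero (Finset.mem_filter.1 he).1 (Finset.mem_filter.1 he).2,
    add_zero] at h1
  exact h1

/-- Without truncation the quota is met exactly, so truncating at the cutting height cannot lower
any value. -/
lemma le_cut (h : P.IsFilledRank v z n) {e : E} (he : e ∈ P.star v) (hr : P.rank v e = n) :
    z e ≤ P.cutHeight v z := by
  have h1 := h.cut_spec.2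
  rw [← h.upper_eq, upper_eq_add (n := n), add_right_inj] at h1
  have := (Finset.sum_eq_sum_iff_of_le fun a _ => min_le_right _ _).1 h1 e
    (Finset.mem_filter.2 ⟨he, hr⟩)
  exact min_eq_right_iff.1 this

lemma cut_pos (h : P.IsFilledRank v z n) : 0 < P.cutHeight v z := by
  refine h.cut_spec.1.lt_of_ne fun h0 => h.sum_tie_pos.not_ge (Finset.sum_nonpos fun e he => ?_)
  rw [h0]
  exact h.le_cut (Finset.mem_filter.1 he).1 (Finset.mem_filter.1 he).2

/-- The maximum of `z` on the critical tie solves the cutting equation, and `cutHeight` is the least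
solution. -/
lemma exists_eq_cut (h : P.IsFilledRank v z n) :
    ∃ e ∈ P.star v, P.rank v e = n ∧ z e = P.cutHeight v z := by
  obtain ⟨a, ha, han⟩ := h.nonempty
  obtain ⟨e, he, hmax⟩ := Finset.exists_max_image ((P.star v).filter (fun e => P.rank v e = n)) z
    ⟨a, Finset.mem_filter.2 ⟨ha, han⟩⟩
  rw [Finset.mem_filter] at he
  refine ⟨e, he.1, he.2, le_antisymm (h.le_cut he.1 he.2) (h.cut_le (h.nonneg e he.1) ?_)⟩
  rw [← h.upper_eq, upper_eq_add (n := n), add_right_inj]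
  exact Finset.sum_congr rfl fun b hb => min_eq_right (hmax b hb)

lemma mem_head (h : P.IsFilledRank v z n) {e : E} :
    e ∈ P.head z v ↔ e ∈ P.star v ∧ P.rank v e = n ∧ z e = P.cutHeight v z := by
  rw [head, if_pos h.filled, Finset.mem_filter, h.mem_critTie, and_assoc]

lemma mem_tail (h : P.IsFilledRank v z n) {e : E} :
    e ∈ P.tail z v ↔ e ∈ P.star v ∧
      (n < P.rank v e ∨ P.rank v e = n ∧ z e < P.cutHeight v z) := by
  rw [tail, if_pos h.filled, Finset.mem_union, Finset.mem_sdiff, h.mem_begEdges, h.mem_head,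
    h.mem_critTie]
  constructor
  · rintro (⟨he, hr⟩ | ⟨⟨he, hr⟩, hn⟩)
    · exact ⟨he, Or.inl hr⟩
    · exact ⟨he, Or.inr ⟨hr, (h.le_cut he hr).lt_of_ne fun h' => hn ⟨he, hr, h'⟩⟩⟩
  · rintro ⟨he, hr | ⟨hr, hlt⟩⟩
    · exact Or.inl ⟨he, hr⟩
    · exact Or.inr ⟨⟨he, hr⟩, fun h' => hlt.ne h'.2.2⟩

lemma head_nonempty (h : P.IsFilledRank v z n) : (P.head z v).Nonempty := by
  obtain ⟨e, he, hr, hc⟩ := h.exists_eq_cut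
  exact ⟨e, h.mem_head.2 ⟨he, hr, hc⟩⟩

end IsFilledRank

lemma head_subset_star : P.head z v ⊆ P.star v := by
  intro e he
  rw [head] at he
  split_ifs at he
  · exact (Finset.mem_filter.1 (Finset.mem_filter.1 he).1).1
  · simp at he

lemma head_subset_critTie : P.head z v ⊆ P.critTie v z := by
  intro e he
  rw [head] at he
  split_ifs at he
  · exact (Finset.mem_filter.1 he).1
  · simp at he

lemma disjoint_head_tail (hz : ∀ e ∈ P.star v, 0 ≤ z e) {e : E} (he : e ∈ P.head z v) :
    e ∉ P.tail z v := by
  by_cases hf : P.FullyFilled z v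
  · obtain ⟨n, hn⟩ := exists_isFilledRank hz hf
    rw [hn.mem_head] at he
    rw [hn.mem_tail]
    rintro ⟨-, h | h⟩
    · omega
    · exact h.2.ne he.2.2
  · simp [head, hf] at he

lemma tail_of_not_fullyFilled (h : ¬ P.FullyFilled z v) : P.tail z v = P.star v := if_neg h

/-! ### Interesting edges -/

/-- Fully stationary assignments are exactly those that respect bounds and quotas. -/
lemma fullyStationary_iff : P.FullyStationary x ↔
    (∀ e, 0 ≤ x e ∧ x e ≤ P.b e) ∧ ∀ v, P.size v x ≤ P.q v :=
  and_congr_right fun hb => forall_congr' fun _ =>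
    ⟨size_le_of_choice_eq fun e _ => (hb e).1, fun h e _ => choice_eq_self h e⟩

lemma size_update {e : E} (he : e ∈ P.star v) (t : ℝ) :
    P.size v (Function.update x e t) = P.size v x + (t - x e) := by
  rw [← upper_zero, ← upper_zero, upper_update he]; simp

lemma update_nonneg (hx : ∀ e ∈ P.star v, 0 ≤ x e) {e : E} {t : ℝ} (ht : 0 ≤ t) :
    ∀ a ∈ P.star v, 0 ≤ Function.update x e t a := by
  intro a ha
  by_cases h : a = e
  · subst h; simpa using ht
  · simpa [h] using hx a ha

lemma Interesting.lt_b {e : E} (h : P.Interesting v x e) : x e < P.b e := by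
  obtain ⟨t, h1, h2, -⟩ := h
  exact h1.trans_le h2

lemma IsFilledRank.size_update_gt (h : P.IsFilledRank v x n) {e : E} (he : e ∈ P.star v) {t : ℝ}
    (ht : x e < t) : P.q v < P.size v (Function.update x e t) := by
  have := h.filled
  rw [FullyFilled] at this
  rw [size_update he]
  linarith

lemma IsFilledRank.update_of_rank_le (h : P.IsFilledRank v x n) {e : E} (he : e ∈ P.star v) {t : ℝ}
    (ht : x e < t) (hr : P.rank v e ≤ n) : P.IsCritRank v (Function.update x e t) n where
  nonneg := update_nonneg h.nonneg ((h.nonneg e he).trans ht.le)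
  lt := by
    rw [upper_update he, if_neg (by omega), add_zero]
    exact h.lt
  le := by
    rw [upper_update he]
    have := h.le
    split_ifs <;> linarith

/-- Raising an edge outside the tail keeps the critical rank. Below the critical tie the surplus is
cut to zero; on the head it is cut at a height no larger than before, because the old height still
solves the cutting equation. -/
lemma IsFilledRank.mem_tail_of_interesting (h : P.IsFilledRank v x n) {e : E}
    (he : e ∈ P.star v) (hi : P.Interesting v x e) : e ∈ P.tail x v := by
  obtain ⟨t, ht, -, hc⟩ := hi
  by_contra hn
  rw [h.mem_tail] at hn
  push Not at hn
  have hle := (hn he).1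
  have hz := h.update_of_rank_le he ht hle
  rw [hz.choice_of_size_gt (h.size_update_gt he ht) he, if_neg hle.not_gt] at hc
  split_ifs at hc with hr
  · have h1 : x e = P.cutHeight v x := le_antisymm (h.le_cut he hr) ((hn he).2 hr)
    refine hc.not_ge ((min_le_left _ _).trans ?_)
    rw [h1]
    refine hz.cut_le h.cut_spec.1 ?_
    rw [upper_update he, if_neg (by omega), add_zero, ← h.upper_eq, upper_eq_add (n := n),
      add_right_inj]
    refine Finset.sum_congr rfl fun a ha => ?_
    rw [Finset.mem_filter] at ha
    by_cases hae : a = e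
    · subst hae; rw [← h1]; simpa using ht.le
    · simpa [hae] using h.le_cut ha.1 ha.2
  · exact hc.not_ge (h.nonneg e he)

lemma IsFilledRank.interesting_of_mem_tail (h : P.IsFilledRank v x n) {e : E}
    (he : e ∈ P.tail x v) (hb : x e < P.b e) : P.Interesting v x e := by
  obtain ⟨he, hr | ⟨hr, hc⟩⟩ := h.mem_tail.1 he
  -- Using at most half of the gap between the better ties and the quota keeps the critical tie in
  -- place.
  · set t := min (P.b e) (x e + (P.q v - P.upper v x (n + 1)) / 2) with ht
    have hlt := h.lt
    have h1 : x e < t := lt_min hb (by linarith)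
    have h2 : t ≤ x e + (P.q v - P.upper v x (n + 1)) / 2 := min_le_right _ _
    refine ⟨t, h1, min_le_left _ _, ?_⟩
    have hz : P.IsCritRank v (Function.update x e t) n := by
      refine ⟨update_nonneg h.nonneg ((h.nonneg e he).trans h1.le), ?_, ?_⟩
      · rw [upper_update he, if_pos (by omega)]; linarith
      · rw [upper_update he, if_pos hr.le]; linarith [h.le]
    rw [hz.choice_of_size_gt (h.size_update_gt he h1) he, if_pos hr]
    simpa using h1
  · refine ⟨P.b e, hb, le_rfl, ?_⟩
    have hz := h.update_of_rank_le he hb hr.le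
    rw [hz.choice_of_size_gt (h.size_update_gt he hb) he, if_neg hr.not_gt, if_pos hr]
    refine lt_min ?_ (by simpa using hb)
    -- A new height of at most `x e` would leave no edge of the tie above its old value and push a
    -- head edge strictly below it, so the quota would be missed.
    by_contra! hcut
    obtain ⟨a, ha, har, hac⟩ := h.exists_eq_cut
    have h1 := hz.cut_spec.2
    rw [upper_update he, if_neg (by omega), add_zero, ← h.upper_eq, upper_eq_add (n := n),
      add_right_inj] at h1
    refine h1.not_lt (Finset.sum_lt_sum (fun c _ => ?_) ⟨a, by simp [ha, har], ?_⟩)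
    · by_cases hce : c = e
      · subst hce; exact (min_le_left _ _).trans hcut
      · simp [hce]
    · exact (min_le_left _ _).trans_lt (hcut.trans_lt (hc.trans_eq hac.symm))

lemma interesting_iff (hx : P.FullyStationary x) {e : E} (he : e ∈ P.star v) :
    P.Interesting v x e ↔ x e < P.b e ∧ e ∈ P.tail x v := by
  obtain ⟨hb, hs⟩ := fullyStationary_iff.1 hx
  by_cases hf : P.FullyFilled x v
  · obtain ⟨n, hn⟩ := exists_isFilledRank (fun e _ => (hb e).1) hf
    exact ⟨fun h => ⟨h.lt_b, hn.mem_tail_of_interesting he h⟩,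
      fun h => hn.interesting_of_mem_tail h.2 h.1⟩
  · rw [tail_of_not_fullyFilled hf]
    refine ⟨fun h => ⟨h.lt_b, he⟩, fun h => ?_⟩
    have hlt : P.size v x < P.q v := (hs v).lt_of_ne hf
    have h1 : x e < min (P.b e) (x e + (P.q v - P.size v x)) := lt_min h.1 (by linarith)
    refine ⟨_, h1, min_le_left _ _, ?_⟩
    rw [choice_eq_self]
    · simpa using h1
    · rw [size_update he]
      linarith [min_le_right (P.b e) (x e + (P.q v - P.size v x))]

/-- By `interesting_iff`, being interesting means spare capacity plus membership in the tail;
blocking edges are used below only in this form. -/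
lemma stable_iff : P.Stable x ↔ P.FullyStationary x ∧
    ∀ e, x e < P.b e → e ∈ P.tail x (Sum.inr (P.right e)) → e ∉ P.tail x (Sum.inl (P.left e)) := by
  refine and_congr_right fun hx => forall_congr' fun e => ?_
  rw [Blocking, interesting_iff hx (P.mem_star_left e), interesting_iff hx (P.mem_star_right e)]
  tauto

/-! ### Preferences -/

/-- If the choice from the join were `x`, the raised edge `e` would have to be truncated while a
head edge `a` keeps its positive value. So `e` is in no better tie than `a`, hence in the same one,
with new height `x e < x a`; but then `a` would be cut too. -/
lemma IsFilledRank.not_prefAt (h : P.IsFilledRank v x n) {e : E} (he : e ∈ P.tail x v)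
    (hlt : x e < y e) : ¬ P.PrefAt v x y := by
  intro hp
  have hes := (h.mem_tail.1 he).1
  have hz0 : ∀ a ∈ P.star v, 0 ≤ max (x a) (y a) :=
    fun a ha => (h.nonneg a ha).trans (le_max_left _ _)
  have hs : P.q v < P.size v (fun a => max (x a) (y a)) := by
    rw [← h.filled]
    exact Finset.sum_lt_sum (fun a _ => le_max_left _ _) ⟨e, hes, hlt.trans_le (le_max_right _ _)⟩
  obtain ⟨m, hm⟩ := exists_isCritRank hz0 hs.le
  obtain ⟨a, ha, har, hac⟩ := h.exists_eq_cut
  have hpos := h.cut_pos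
  have h1 := hp e hes
  have h2 := hp a ha
  rw [hm.choice_of_size_gt hs hes] at h1
  rw [hm.choice_of_size_gt hs ha] at h2
  have hlt' : x e < max (x e) (y e) := hlt.trans_le (le_max_right _ _)
  have hme : P.rank v e ≤ m := by
    by_contra! hc
    rw [if_pos hc] at h1
    exact hlt'.ne' h1
  have hma : m ≤ P.rank v a := by
    by_contra! hc
    rw [if_neg (by omega), if_neg (by omega)] at h2
    linarith
  obtain ⟨-, hr | ⟨hr, hc⟩⟩ := h.mem_tail.1 he
  · omega
  · rw [if_neg (by omega), if_pos (by omega)] at h1 h2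
    have h3 : P.cutHeight v (fun a => max (x a) (y a)) = x e := by
      rcases min_choice (P.cutHeight v fun a => max (x a) (y a)) (max (x e) (y e)) with h | h
      · rw [← h, h1]
      · rw [h] at h1; exact absurd h1 hlt'.ne'
    have h4 := (min_le_left (P.cutHeight v fun a => max (x a) (y a)) (max (x a) (y a)))
    linarith

/-- Both equal the choice from their join, which is symmetric in `x` and `y`. -/
lemma IsXmax.eq {x y : E → ℝ} (hx : P.IsXmax x) (hy : P.IsXmax y) : x = y := by
  funext e
  rw [← hx.2 y hy.1 _ e (P.mem_star_right e), ← hy.2 x hx.1 _ e (P.mem_star_right e)]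
  simp only [max_comm]

lemma IsXmin.eq {x y : E → ℝ} (hx : P.IsXmin x) (hy : P.IsXmin y) : x = y := by
  funext e
  rw [← hx.2 y hy.1 _ e (P.mem_star_right e), ← hy.2 x hx.1 _ e (P.mem_star_right e)]
  simp only [max_comm]

/-! ### Dependence on the values at a vertex only -/

section Congr

variable (h : ∀ e ∈ P.star v, x e = y e)

include h

lemma size_congr : P.size v x = P.size v y := Finset.sum_congr rfl h

lemma fullyFilled_congr : P.FullyFilled x v ↔ P.FullyFilled y v := by
  rw [FullyFilled, FullyFilled, size_congr h]

lemma critTie_congr : P.critTie v x = P.critTie v y := by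
  ext e
  rw [mem_critTie, mem_critTie, upper_congr fun e he _ => h e he, upper_congr fun e he _ => h e he]

lemma begEdges_congr : P.begEdges v x = P.begEdges v y := by
  rw [begEdges, begEdges, critTie_congr h]

lemma cutHeight_congr : P.cutHeight v x = P.cutHeight v y := by
  have h1 : ∑ e ∈ P.begEdges v x, x e = ∑ e ∈ P.begEdges v y, y e := by
    rw [begEdges_congr h]
    exact Finset.sum_congr rfl fun e he => h e (Finset.mem_filter.1 he).1
  have h2 : ∀ r, ∑ e ∈ P.critTie v x, min r (x e) = ∑ e ∈ P.critTie v y, min r (y e) := by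
    intro r
    rw [critTie_congr h]
    exact Finset.sum_congr rfl fun e he => by rw [h e (Finset.mem_filter.1 he).1]
  simp only [cutHeight, h1, h2]

lemma head_congr : P.head x v = P.head y v := by
  simp only [head, fullyFilled_congr h, critTie_congr h, cutHeight_congr h]
  split_ifs
  · exact Finset.filter_congr fun e he => by rw [h e (Finset.mem_filter.1 he).1]
  · rfl

lemma tail_congr : P.tail x v = P.tail y v := by
  simp only [tail, fullyFilled_congr h, critTie_congr h, begEdges_congr h, head_congr h]

end Congr

end

/-! ### Active graph, maximal components, balanced functions and rotations. -/

section

variable {F W E : Type*} [Fintype E] {P : MixedProblem F W E} {v : F ⊕ W} {x y : E → ℝ} {n : ℕ}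
  {L L' : Set (F ⊕ W)}

/-! ### The active graph -/

lemma mem_candidates {f : F} {e : E} : e ∈ P.candidates x f ↔
    P.left e = f ∧ x e < P.b e ∧ e ∈ P.tail x (Sum.inr (P.right e)) := by
  rw [candidates, Finset.mem_filter, mem_star_inl]

lemma mem_potHead {f : F} {e : E} : e ∈ P.potHead x f ↔
    e ∈ P.candidates x f ∧ P.NoDeficitAbove x f e ∧
      ∀ e' ∈ P.candidates x f, P.NoDeficitAbove x f e' → P.geq (Sum.inl f) e e' := by
  rw [potHead, Finset.mem_filter]

/-- During a shift candidates may be lost but not gained; if those of the old potential head remain,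
the best tie and the candidates in it stay the same. -/
lemma potHead_eq {f : F} (hcand : P.candidates y f ⊆ P.candidates x f)
    (hD : P.potHead x f ⊆ P.candidates y f) (hne : (P.potHead x f).Nonempty)
    (hnda : ∀ e ∈ P.candidates x f, P.NoDeficitAbove y f e ↔ P.NoDeficitAbove x f e) :
    P.potHead y f = P.potHead x f := by
  have hstar : ∀ a ∈ P.candidates x f, a ∈ P.star (Sum.inl f) :=
    fun a ha => P.mem_star_inl.2 (mem_candidates.1 ha).1
  obtain ⟨d, hd⟩ := hne
  ext e
  constructor
  · intro he
    rw [mem_potHead] at he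
    have hec := hcand he.1
    have hd' := mem_potHead.1 hd
    refine mem_potHead.2 ⟨hec, (hnda e hec).1 he.2.1, fun a ha hna => ?_⟩
    have h1 := he.2.2 d (hD hd) ((hnda d hd'.1).2 hd'.2.1)
    have h2 := hd'.2.2 a ha hna
    rw [← P.rank_le_iff (hstar _ hec) (hstar _ hd'.1)] at h1
    rw [← P.rank_le_iff (hstar _ hd'.1) (hstar _ ha)] at h2
    exact (P.rank_le_iff (hstar _ hec) (hstar _ ha)).1 (h2.trans h1)
  · intro he
    have he' := mem_potHead.1 he
    exact mem_potHead.2 ⟨hD he, (hnda e he'.1).2 he'.2.1,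
      fun a ha hna => he'.2.2 a (hcand ha) ((hnda a (hcand ha)).1 hna)⟩

lemma left_of_mem_potHead {f : F} {e : E} (h : e ∈ P.potHead x f) : P.left e = f :=
  (mem_candidates.1 (mem_potHead.1 h).1).1

lemma right_of_mem_head {w : W} {e : E} (h : e ∈ P.head x (Sum.inr w)) : P.right e = w :=
  P.mem_star_inr.1 (head_subset_star h)

lemma fullyFilled_of_mem_potHead {f : F} {e : E} (h : e ∈ P.potHead x f) :
    P.FullyFilled x (Sum.inr (P.right e)) := by
  have h1 := mem_potHead.1 h
  have h2 := mem_candidates.1 h1.1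
  have h3 := P.mem_star_inl.2 h2.1
  exact h1.2.1 e h3 ((P.rank_le_iff h3 h3).1 le_rfl) h2.2.1

lemma Arc.regular_left {u v : F ⊕ W} (h : P.Arc x u v) : P.Regular x u := by
  cases h with
  | toW e he => exact he.1
  | toF e he => exact he.1

/-- Cleaning runs backwards along these edges: a singular or deficit end would already have made the
start singular. -/
lemma Arc.regular_right {u v : F ⊕ W} (h : P.Arc x u v) : P.Regular x v := by
  cases h with
  | toW e he =>
    exact ⟨fullyFilled_of_mem_potHead he.2, fun hs => he.1.2 (.stepF e he.1.1 he.2 hs)⟩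
  | toF e he =>
    have hf : P.FullyFilled x (Sum.inl (P.left e)) := by
      by_contra hf
      exact he.1.2 (.deficit e he.1.1 he.2 hf)
    exact ⟨hf, fun hs => he.1.2 (.stepW e he.1.1 he.2 hs)⟩

lemma Arc.ne {u v : F ⊕ W} (h : P.Arc x u v) : u ≠ v := by
  cases h <;> simp

lemma Reach.regular {u v : F ⊕ W} (h : P.Reach x u v) (hu : P.Regular x u) : P.Regular x v := by
  induction h with
  | refl => exact hu
  | tail _ h _ => exact h.regular_right

lemma Regular.exists_arc (hx : P.FullyStationary x) {u : F ⊕ W} (h : P.Regular x u) :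
    ∃ v, P.Arc x u v := by
  rcases u with f | w
  · have hne : (P.potHead x f).Nonempty := by
      rw [Finset.nonempty_iff_ne_empty]
      exact fun h0 => h.2 (.empty f h.1 h0)
    obtain ⟨e, he⟩ := hne
    obtain rfl := left_of_mem_potHead he
    exact ⟨_, .toW e ⟨h, he⟩⟩
  · obtain ⟨n, hn⟩ := exists_isFilledRank (fun e _ => (hx.1 e).1) h.1
    obtain ⟨e, he⟩ := hn.head_nonempty
    obtain rfl := right_of_mem_head he
    exact ⟨_, .toF e ⟨h, he⟩⟩

/-! ### Maximal strong components -/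

namespace IsStrongComponent

lemma exists_arc_out (h : P.IsStrongComponent x L) {u : F ⊕ W} (hu : u ∈ L) :
    ∃ v, P.Arc x u v := by
  obtain ⟨v, hv, hne⟩ := h.1.exists_ne u
  rcases Relation.ReflTransGen.cases_head (h.2.1 u hu v hv) with h | ⟨c, hc, -⟩
  · exact absurd h.symm hne
  · exact ⟨c, hc⟩

lemma regular (h : P.IsStrongComponent x L) {u : F ⊕ W} (hu : u ∈ L) : P.Regular x u :=
  (h.exists_arc_out hu).choose_spec.regular_left

lemma eq_of_mem (h : P.IsStrongComponent x L) (h' : P.IsStrongComponent x L') {u : F ⊕ W}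
    (hu : u ∈ L) (hu' : u ∈ L') : L = L' := by
  ext v
  exact ⟨fun hv => h'.2.2 u hu' v (h.2.1 u hu v hv) (h.2.1 v hv u hu),
    fun hv => h.2.2 u hu v (h'.2.1 u hu' v hv) (h'.2.1 v hv u hu')⟩

end IsStrongComponent

/-- Among the vertices reachable from `v`, take one whose own reachable set is smallest: everything
in that set reaches back. It has a second vertex because regular vertices have outgoing arcs and
there are no loops. -/
lemma Regular.exists_reach_strongComponent [Finite F] [Finite W] (hx : P.FullyStationary x)
    (hv : P.Regular x v) : ∃ L', P.IsStrongComponent x L' ∧ ∃ u ∈ L', P.Reach x v u := by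
  obtain ⟨u, hu, hmin⟩ := Set.exists_min_image {u | P.Reach x v u}
    (fun u => Set.ncard {a | P.Reach x u a}) (Set.toFinite _) ⟨v, .refl⟩
  have hback : ∀ a, P.Reach x u a → P.Reach x a u := by
    intro a ha
    have hsub : {c | P.Reach x a c} ⊆ {c | P.Reach x u c} := fun c hc => ha.trans hc
    have := Set.eq_of_subset_of_ncard_le hsub (hmin a (hu.trans ha))
    exact this.symm.subset (.refl : P.Reach x u u)
  refine ⟨{a | P.Reach x u a}, ⟨?_, fun a ha c hc => (hback a ha).trans hc,
    fun a ha c hac _ => ha.trans hac⟩, u, .refl, hu⟩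
  obtain ⟨a, ha⟩ := (Reach.regular hu hv).exists_arc hx
  exact ⟨u, .refl, a, .single ha, ha.ne⟩

namespace IsMaximalComponent

/-- Every vertex reachable from `L` leads on to some strong component, which by maximality is `L`
itself. -/
lemma mem_of_reach [Finite F] [Finite W] (hL : P.IsMaximalComponent x L)
    (hx : P.FullyStationary x) {u : F ⊕ W} (hu : u ∈ L) (h : P.Reach x u v) : v ∈ L := by
  obtain ⟨L', hL', a, ha, hva⟩ := (h.regular (hL.1.regular hu)).exists_reach_strongComponent hx
  obtain rfl := hL.2 L' hL' ⟨u, hu, a, ha, h.trans hva⟩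
  exact hL.1.2.2 u hu v h (hva.trans (hL.1.2.1 a ha u hu))

lemma right_mem [Finite F] [Finite W] (hL : P.IsMaximalComponent x L)
    (hx : P.FullyStationary x) {f : F} (hf : Sum.inl f ∈ L) {e : E} (he : e ∈ P.potHead x f) :
    Sum.inr (P.right e) ∈ L := by
  obtain rfl := left_of_mem_potHead he
  exact hL.mem_of_reach hx hf (.single (.toW e ⟨hL.1.regular hf, he⟩))

lemma left_mem [Finite F] [Finite W] (hL : P.IsMaximalComponent x L)
    (hx : P.FullyStationary x) {w : W} (hw : Sum.inr w ∈ L) {e : E}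
    (he : e ∈ P.head x (Sum.inr w)) : Sum.inl (P.left e) ∈ L := by
  obtain rfl := right_of_mem_head he
  exact hL.mem_of_reach hx hw (.single (.toF e ⟨hL.1.regular hw, he⟩))

/-- A maximal component persists if fullness, and the heads and potential heads of its vertices,
are unchanged. -/
lemma transfer [Finite F] [Finite W] (hL : P.IsMaximalComponent x L) (hx : P.FullyStationary x)
    (hfull : ∀ v, P.FullyFilled y v ↔ P.FullyFilled x v)
    (hhead : ∀ w, Sum.inr w ∈ L → P.head y (Sum.inr w) = P.head x (Sum.inr w))
    (hpot : ∀ f, Sum.inl f ∈ L → P.potHead y f = P.potHead x f) :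
    (∀ v ∈ L, P.Regular y v) ∧ (∀ u ∈ L, ∀ v, P.Arc y u v ↔ P.Arc x u v) ∧
      P.IsMaximalComponent y L := by
  -- The heads and potential heads of `L` lead only into `L`, so the cleaning procedure for `y` has
  -- no way to enter it.
  have hsing : ∀ v, P.Singular y v → v ∉ L := by
    intro v hv
    induction hv with
    | deficit e hf he hl =>
      intro hw
      rw [hhead _ hw] at he
      exact hl ((hfull _).2 (hL.1.regular (hL.left_mem hx hw he)).1)
    | empty f hf h0 =>
      intro hfL
      rw [hpot _ hfL] at h0
      exact (hL.1.regular hfL).2 (.empty f (hL.1.regular hfL).1 h0)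
    | stepF e hf he _ ih =>
      intro hfL
      rw [hpot _ hfL] at he
      exact ih (hL.right_mem hx hfL he)
    | stepW e hf he _ ih =>
      intro hw
      rw [hhead _ hw] at he
      exact ih (hL.left_mem hx hw he)
  have hreg : ∀ v ∈ L, P.Regular y v := fun v hv =>
    ⟨(hfull v).2 (hL.1.regular hv).1, fun hs => hsing v hs hv⟩
  have harc : ∀ u ∈ L, ∀ v, P.Arc y u v ↔ P.Arc x u v := by
    intro u hu v
    constructor
    · rintro (⟨e, he⟩ | ⟨e, he⟩)
      · exact .toW e ⟨hL.1.regular hu, hpot _ hu ▸ he.2⟩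
      · exact .toF e ⟨hL.1.regular hu, hhead _ hu ▸ he.2⟩
    · rintro (⟨e, he⟩ | ⟨e, he⟩)
      · exact .toW e ⟨hreg _ hu, (hpot _ hu).symm ▸ he.2⟩
      · exact .toF e ⟨hreg _ hu, (hhead _ hu).symm ▸ he.2⟩
  have hto : ∀ {u v}, P.Reach y u v → u ∈ L → v ∈ L ∧ P.Reach x u v := by
    intro u v h hu
    induction h with
    | refl => exact ⟨hu, .refl⟩
    | tail _ h ih =>
      have h' := (harc _ ih.1 _).1 h
      exact ⟨hL.mem_of_reach hx ih.1 (.single h'), ih.2.tail h'⟩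
  have hfrom : ∀ {u v}, P.Reach x u v → u ∈ L → P.Reach y u v := by
    intro u v h hu
    induction h with
    | refl => exact .refl
    | tail h0 h ih => exact ih.tail ((harc _ (hL.mem_of_reach hx hu h0) _).2 h)
  have hstrong : P.IsStrongComponent y L :=
    ⟨hL.1.1, fun u hu v hv => hfrom (hL.1.2.1 u hu v hv) hu, fun u hu v h _ => (hto h hu).1⟩
  refine ⟨hreg, harc, hstrong, fun L' hL' ⟨u, hu, v, hv, huv⟩ => ?_⟩
  exact hL'.eq_of_mem hstrong hv (hto huv hu).1

end IsMaximalComponent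

namespace IsNormalizedAlignedCirculation

lemma eq_of_proportional {ρ ρ' : E → ℤ} (h : P.IsNormalizedAlignedCirculation ρ)
    (h' : P.IsNormalizedAlignedCirculation ρ') {s : ℝ} (hs : 0 < s)
    (heq : ∀ e, (ρ e : ℝ) = s * ρ' e) : ρ = ρ' := by
  obtain ⟨a, ha⟩ := Function.ne_iff.1 h'.ne_zero
  -- Cross-multiplication removes the real factor; comparing gcds then gives `|ρ' a| = |ρ a|`, and
  -- `0 < s` fixes the sign.
  have hmul : ∀ e, ρ' a * ρ e = ρ a * ρ' e := fun e => by
    have : (ρ' a : ℝ) * ρ e = ρ a * ρ' e := by rw [heq e, heq a]; ring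
    exact_mod_cast this
  have hg : Finset.univ.gcd (fun e => ρ' a * ρ e) = Finset.univ.gcd (fun e => ρ a * ρ' e) :=
    Finset.gcd_congr rfl fun e _ => hmul e
  rw [Finset.gcd_mul_left, Finset.gcd_mul_left, show Finset.univ.gcd (fun e => ρ e) = 1 from
    h.normalized, show Finset.univ.gcd (fun e => ρ' e) = 1 from h'.normalized, mul_one, mul_one,
    ← Int.abs_eq_normalize, ← Int.abs_eq_normalize, abs_eq_abs] at hg
  have haa : ρ' a = ρ a := by
    refine hg.resolve_right fun hneg => ?_
    have h1 := heq a
    have h2 : (ρ' a : ℝ) = -ρ a := by exact_mod_cast hneg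
    have h3 : (ρ' a : ℝ) ≠ 0 := by exact_mod_cast ha
    refine h3 ((mul_eq_zero.1 (?_ : (1 + s) * (ρ' a : ℝ) = 0)).resolve_left (by positivity))
    linarith
  funext e
  exact mul_left_cancel₀ ha ((hmul e).trans (by rw [haa]))

end IsNormalizedAlignedCirculation

/-! ### Balanced functions -/

variable [Fintype F] [Fintype W] {φ φ' : F → ℝ} {ψ ψ' : W → ℝ} {ε ε' : ℝ} {ρ ρ' : E → ℤ}

namespace IsBalanced

/-- The balance at `v` equates its value, up to a factor, with the sum over incoming arcs. The terms
are nonnegative, so zeros spread backwards. -/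
lemma eq_zero_of_arc (h : P.IsBalanced x φ ψ ε) {u v : F ⊕ W} (ha : P.Arc x u v)
    (hv : Sum.elim φ ψ v = 0) : Sum.elim φ ψ u = 0 := by
  have hr := ha.regular_right
  cases ha with
  | toW e he =>
    have h1 := h.balanceW _ hr
    rw [show ψ (P.right e) = 0 from hv, mul_zero, zero_sub, neg_eq_zero] at h1
    exact (Finset.sum_eq_zero_iff_of_nonneg fun _ _ => h.nonnegF _).1 h1 e
      (Finset.mem_filter.2 ⟨P.mem_star_right e, he⟩)
  | toF e he =>
    have h1 := h.balanceF _ hr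
    rw [show φ (P.left e) = 0 from hv, mul_zero, zero_sub, neg_eq_zero] at h1
    exact (Finset.sum_eq_zero_iff_of_nonneg fun _ _ => h.nonnegW _).1 h1 e
      (Finset.mem_filter.2 ⟨P.mem_star_left e, he⟩)

lemma eq_zero_of_reach (h : P.IsBalanced x φ ψ ε) {u v : F ⊕ W} (ha : P.Reach x u v)
    (hv : Sum.elim φ ψ v = 0) : Sum.elim φ ψ u = 0 := by
  induction ha with
  | refl => exact hv
  | tail _ h' ih => exact ih (h.eq_zero_of_arc h' hv)

lemma eq_zero_of_mem (h : P.IsBalanced x φ ψ ε) (hL : P.IsStrongComponent x L)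
    (hφ : ∀ f, Sum.inl f ∉ L → φ f = 0) (hψ : ∀ w, Sum.inr w ∉ L → ψ w = 0)
    (hv : v ∈ L) (h0 : Sum.elim φ ψ v = 0) (u : F ⊕ W) : Sum.elim φ ψ u = 0 := by
  by_cases hu : u ∈ L
  · exact h.eq_zero_of_reach (hL.2.1 u hu v hv) h0
  · rcases u with f | w
    · exact hφ f hu
    · exact hψ w hu

lemma nonneg (h : P.IsBalanced x φ ψ ε) (u : F ⊕ W) : 0 ≤ Sum.elim φ ψ u := by
  rcases u with f | w
  · exact h.nonnegF f
  · exact h.nonnegW w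

lemma pos (h : P.IsBalanced x φ ψ ε) (hL : P.IsStrongComponent x L)
    (hφ : ∀ f, Sum.inl f ∉ L → φ f = 0) (hψ : ∀ w, Sum.inr w ∉ L → ψ w = 0) (hε : 0 < ε)
    (hv : v ∈ L) : 0 < Sum.elim φ ψ v := by
  refine (h.nonneg v).lt_of_ne fun h0 => hε.ne' ?_
  have hz := h.eq_zero_of_mem hL hφ hψ hv h0.symm
  have hz1 : ∀ f, φ f = 0 := fun f => hz (Sum.inl f)
  have hz2 : ∀ w, ψ w = 0 := fun w => hz (Sum.inr w)
  simpa [hz1, hz2] using h.total.symm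

lemma sub_mul (h : P.IsBalanced x φ ψ ε) (h' : P.IsBalanced x φ' ψ' ε') (t : ℝ)
    (hF : ∀ f, 0 ≤ φ f - t * φ' f) (hW : ∀ w, 0 ≤ ψ w - t * ψ' w) :
    P.IsBalanced x (fun f => φ f - t * φ' f) (fun w => ψ w - t * ψ' w) (ε - t * ε') where
  suppF f hf := by simp [h.suppF f hf, h'.suppF f hf]
  suppW w hw := by simp [h.suppW w hw, h'.suppW w hw]
  balanceF f hf := by
    have h1 := h.balanceF f hf
    have h2 := h'.balanceF f hf
    simp only [Finset.sum_sub_distrib, ← Finset.mul_sum]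
    linear_combination h1 - t * h2
  balanceW w hw := by
    have h1 := h.balanceW w hw
    have h2 := h'.balanceW w hw
    simp only [Finset.sum_sub_distrib, ← Finset.mul_sum]
    linear_combination h1 - t * h2
  total := by
    have h1 := h.total
    have h2 := h'.total
    simp only [mul_sub, Finset.sum_sub_distrib, mul_left_comm _ t, ← Finset.mul_sum]
    linear_combination h1 - t * h2
  nonnegF := hF
  nonnegW := hW

/-- Two balanced pairs supported by a strong component are proportional. -/
lemma exists_eq_mul (h : P.IsBalanced x φ ψ ε) (h' : P.IsBalanced x φ' ψ' ε')
    (hL : P.IsStrongComponent x L)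
    (hφ : ∀ f, Sum.inl f ∉ L → φ f = 0) (hψ : ∀ w, Sum.inr w ∉ L → ψ w = 0)
    (hφ' : ∀ f, Sum.inl f ∉ L → φ' f = 0) (hψ' : ∀ w, Sum.inr w ∉ L → ψ' w = 0)
    (hε : 0 < ε) (hε' : 0 < ε') :
    ∃ t, 0 < t ∧ (∀ f, φ f = t * φ' f) ∧ ∀ w, ψ w = t * ψ' w := by
  -- As in Perron–Frobenius: subtracting the least ratio times the second pair keeps nonnegativity
  -- and balance and creates a zero at `v`, which spreads over all of `L`.
  obtain ⟨v, hv, hmin⟩ := Set.exists_min_image L (fun v => Sum.elim φ ψ v / Sum.elim φ' ψ' v)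
    (Set.toFinite _) hL.1.nonempty
  have hpos := h.pos hL hφ hψ hε hv
  have hpos' := fun u (hu : u ∈ L) => h'.pos hL hφ' hψ' hε' hu
  set t := Sum.elim φ ψ v / Sum.elim φ' ψ' v with ht
  have hle : ∀ u ∈ L, 0 ≤ Sum.elim φ ψ u - t * Sum.elim φ' ψ' u := fun u hu =>
    sub_nonneg.2 ((le_div_iff₀ (hpos' u hu)).1 (hmin u hu))
  have hF : ∀ f, 0 ≤ φ f - t * φ' f := fun f => by
    by_cases hf : Sum.inl f ∈ L
    · exact hle _ hf
    · simp [hφ f hf, hφ' f hf]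
  have hW : ∀ w, 0 ≤ ψ w - t * ψ' w := fun w => by
    by_cases hw : Sum.inr w ∈ L
    · exact hle _ hw
    · simp [hψ w hw, hψ' w hw]
  have hz := (h.sub_mul h' t hF hW).eq_zero_of_mem hL
    (fun f hf => by simp [hφ f hf, hφ' f hf]) (fun w hw => by simp [hψ w hw, hψ' w hw]) hv (by
      have : Sum.elim φ ψ v - t * Sum.elim φ' ψ' v = 0 := by
        rw [ht, div_mul_cancel₀ _ (hpos' v hv).ne', sub_self]
      rcases v with f | w <;> exact this)
  exact ⟨t, div_pos hpos (hpos' v hv), fun f => sub_eq_zero.1 (hz (Sum.inl f)),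
    fun w => sub_eq_zero.1 (hz (Sum.inr w))⟩

end IsBalanced

/-- Expressed through `L` instead of regularity, the vector can be compared between assignments that
share the component but not all regular vertices. -/
lemma delta_eq (hL : P.IsMaximalComponent x L) (hx : P.FullyStationary x)
    (hφ : ∀ f, Sum.inl f ∉ L → φ f = 0) (hψ : ∀ w, Sum.inr w ∉ L → ψ w = 0) (e : E) :
    P.delta x φ ψ e =
      if Sum.inl (P.left e) ∈ L ∧ e ∈ P.potHead x (P.left e) then φ (P.left e)
      else if Sum.inr (P.right e) ∈ L ∧ e ∈ P.head x (Sum.inr (P.right e)) then -ψ (P.right e)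
      else 0 := by
  by_cases hl : Sum.inl (P.left e) ∈ L
  · have h1 : P.ActiveF x e ↔ e ∈ P.potHead x (P.left e) :=
      and_iff_right (hL.1.regular hl)
    simp only [delta, h1, hl, true_and]
    by_cases hr : Sum.inr (P.right e) ∈ L
    · have h2 : P.ActiveW x e ↔ e ∈ P.head x (Sum.inr (P.right e)) :=
        and_iff_right (hL.1.regular hr)
      simp only [h2, hr, true_and]
    · simp [hr, hψ _ hr]
  · have h2 : ¬ (Sum.inr (P.right e) ∈ L ∧ e ∈ P.head x (Sum.inr (P.right e))) :=
      fun h => hl (hL.left_mem hx h.1 h.2)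
    rw [if_neg (fun h => hl h.1), if_neg h2, delta, hφ _ hl]
    by_cases hr : Sum.inr (P.right e) ∈ L
    · rw [if_neg (c := P.ActiveW x e) (fun h => h2 ⟨hr, h.2⟩)]; simp
    · simp [hψ _ hr]

/-! ### Rotations -/

namespace IsRotation

lemma unique (h : P.IsRotation x L ρ) (h' : P.IsRotation x L ρ') :
    ρ = ρ' := by
  obtain ⟨hL, hN, φ, ψ, ε, hε, hB, hφ, hψ, c, hc, hρ⟩ := h
  obtain ⟨-, hN', φ', ψ', ε', hε', hB', hφ', hψ', c', hc', hρ'⟩ := h'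
  obtain ⟨t, ht, hF, hW⟩ := hB.exists_eq_mul hB' hL.1 hφ hψ hφ' hψ' hε hε'
  refine hN.eq_of_proportional hN' (s := c * t / c') (by positivity) fun e => ?_
  have hd : P.delta x φ ψ e = t * P.delta x φ' ψ' e := by
    simp only [delta, hF, hW]
    split_ifs <;> ring
  rw [hρ, hρ', hd]
  field_simp

section Sign

variable (h : P.IsRotation x L ρ) (hx : P.FullyStationary x)

include h hx

lemma pos_iff {e : E} :
    0 < ρ e ↔ Sum.inl (P.left e) ∈ L ∧ e ∈ P.potHead x (P.left e) := by
  obtain ⟨hL, hN, φ, ψ, ε, hε, hB, hφ, hψ, c, hc, hρ⟩ := h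
  rw [← Int.cast_pos (R := ℝ), hρ, mul_pos_iff_of_pos_left hc, delta_eq hL hx hφ hψ]
  split_ifs with h1 h2
  · exact iff_of_true (hB.pos hL.1 hφ hψ hε h1.1) h1
  · have := hB.nonnegW (P.right e)
    exact iff_of_false (by linarith) h1
  · exact iff_of_false (lt_irrefl _) h1

lemma neg_iff {e : E} :
    ρ e < 0 ↔ Sum.inr (P.right e) ∈ L ∧ e ∈ P.head x (Sum.inr (P.right e)) := by
  obtain ⟨hL, hN, φ, ψ, ε, hε, hB, hφ, hψ, c, hc, hρ⟩ := h
  rw [← Int.cast_lt_zero (R := ℝ), hρ, mul_neg_iff, delta_eq hL hx hφ hψ]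
  simp only [hc, hc.not_gt, true_and, false_and, or_false]
  split_ifs with h1 h2
  · refine iff_of_false (hB.nonnegF _).not_gt fun h2 => ?_
    exact disjoint_head_tail (fun e _ => (hx.1 e).1) h2.2
      (mem_candidates.1 (mem_potHead.1 h1.2).1).2.2
  · exact iff_of_true (neg_neg_of_pos (hB.pos hL.1 hφ hψ hε h2.1)) h2
  · exact iff_of_false (lt_irrefl _) h2

/-- A nonzero edge starts in `L`, and `L` is closed under outgoing arcs, so both of its ends are in
`L`. -/
lemma eq_zero_of_notMem {v : F ⊕ W} (hv : v ∉ L) {e : E} (he : e ∈ P.star v) : ρ e = 0 := by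
  by_contra h0
  have hends : Sum.inl (P.left e) ∈ L ∧ Sum.inr (P.right e) ∈ L := by
    rcases lt_or_gt_of_ne h0 with h1 | h1
    · rw [h.neg_iff hx] at h1
      exact ⟨h.1.left_mem hx h1.1 h1.2, h1.1⟩
    · rw [h.pos_iff hx] at h1
      exact ⟨h1.1, h.1.right_mem hx h1.1 h1.2⟩
  rcases P.mem_star.1 he with rfl | rfl
  · exact hv hends.1
  · exact hv hends.2

lemma shift_eq_of_notMem {v : F ⊕ W} (hv : v ∉ L) {e : E} (he : e ∈ P.star v) (y : E → ℝ) (c : ℝ) :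
    shift y c ρ e = y e := by
  simp [shift, h.eq_zero_of_notMem hx hv he]

omit hx in
lemma size_shift (v : F ⊕ W) (y : E → ℝ) (c : ℝ) : P.size v (shift y c ρ) = P.size v y := by
  have : ∑ e ∈ P.star v, (ρ e : ℝ) = 0 := by exact_mod_cast h.2.1.circulation v
  simp only [size, shift, Finset.sum_add_distrib, ← Finset.mul_sum, this, mul_zero, add_zero]

omit hx in
lemma fullyFilled_shift (v : F ⊕ W) (y : E → ℝ) (c : ℝ) :
    P.FullyFilled (shift y c ρ) v ↔ P.FullyFilled y v := by
  rw [FullyFilled, FullyFilled, h.size_shift]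

omit hx in
lemma fullyStationary_shift (hx : P.FullyStationary y) {c : ℝ}
    (hc : ∀ e, 0 ≤ shift y c ρ e ∧ shift y c ρ e ≤ P.b e) :
    P.FullyStationary (shift y c ρ) :=
  fullyStationary_iff.2 ⟨hc, fun v => (h.size_shift v y c).trans_le ((fullyStationary_iff.1 hx).2 v)⟩

/-- A rotation persists if fullness, and the heads and potential heads of the vertices of its
component, are unchanged. -/
lemma transfer (hy : P.FullyStationary y) (hfull : ∀ v, P.FullyFilled y v ↔ P.FullyFilled x v)
    (hhead : ∀ w, Sum.inr w ∈ L → P.head y (Sum.inr w) = P.head x (Sum.inr w))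
    (hpot : ∀ f, Sum.inl f ∈ L → P.potHead y f = P.potHead x f) : P.IsRotation y L ρ := by
  obtain ⟨hL, hN, φ, ψ, ε, hε, hB, hφ, hψ, c, hc, hρ⟩ := h
  obtain ⟨hreg, harc, hLy⟩ := hL.transfer hx hfull hhead hpot
  refine ⟨hLy, hN, φ, ψ, ε, hε, ?_, hφ, hψ, c, hc, fun e => ?_⟩
  · have hregx : ∀ v ∈ L, P.Regular x v := fun v hv => hL.1.regular hv
    have hnF : ∀ f, ¬ P.Regular y (Sum.inl f) → φ f = 0 := fun f hf => hφ f fun h => hf (hreg _ h)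
    have hnW : ∀ w, ¬ P.Regular y (Sum.inr w) → ψ w = 0 := fun w hw => hψ w fun h => hw (hreg _ h)
    have hsF : ∀ f, ∑ e ∈ (P.star (Sum.inl f)).filter (fun e => P.ActiveW y e), ψ (P.right e) =
        ∑ e ∈ (P.star (Sum.inl f)).filter (fun e => P.ActiveW x e), ψ (P.right e) := by
      intro f
      simp only [Finset.sum_filter]
      refine Finset.sum_congr rfl fun e _ => ?_
      by_cases hr : Sum.inr (P.right e) ∈ L
      · simp only [ActiveW, hreg _ hr, hregx _ hr, hhead _ hr]
      · simp [hψ _ hr]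
    have hsW : ∀ w, ∑ e ∈ (P.star (Sum.inr w)).filter (fun e => P.ActiveF y e), φ (P.left e) =
        ∑ e ∈ (P.star (Sum.inr w)).filter (fun e => P.ActiveF x e), φ (P.left e) := by
      intro w
      simp only [Finset.sum_filter]
      refine Finset.sum_congr rfl fun e _ => ?_
      by_cases hl : Sum.inl (P.left e) ∈ L
      · simp only [ActiveF, hreg _ hl, hregx _ hl, hpot _ hl]
      · simp [hφ _ hl]
    refine ⟨hnF, hnW, fun f _ => ?_, fun w _ => ?_, ?_, hB.nonnegF, hB.nonnegW⟩
    · rw [hsF]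
      by_cases hf : Sum.inl f ∈ L
      · rw [hpot _ hf]; exact hB.balanceF f (hregx _ hf)
      · rw [hφ f hf, mul_zero, zero_sub, neg_eq_zero]
        refine Finset.sum_eq_zero fun e he => ?_
        rw [Finset.mem_filter, mem_star_inl] at he
        refine hψ _ fun hr => hf ?_
        rw [← he.1]
        exact hL.left_mem hx hr he.2.2
    · rw [hsW]
      by_cases hw : Sum.inr w ∈ L
      · rw [hhead _ hw]; exact hB.balanceW w (hregx _ hw)
      · rw [hψ w hw, mul_zero, zero_sub, neg_eq_zero]
        refine Finset.sum_eq_zero fun e he => ?_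
        rw [Finset.mem_filter, mem_star_inr] at he
        refine hφ _ fun hl => hw ?_
        rw [← he.1]
        exact hL.right_mem hx hl he.2.2
    · rw [← hB.total]
      simp only [Finset.sum_filter]
      congr 1
      · refine Finset.sum_congr rfl fun f _ => ?_
        by_cases hf : Sum.inl f ∈ L
        · simp only [hreg _ hf, hregx _ hf, hpot _ hf]
        · simp [hφ _ hf]
      · refine Finset.sum_congr rfl fun w _ => ?_
        by_cases hw : Sum.inr w ∈ L
        · simp only [hreg _ hw, hregx _ hw, hhead _ hw]
        · simp [hψ _ hw]
  · rw [hρ, delta_eq hL hx hφ hψ, delta_eq hLy hy hφ hψ]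
    by_cases hl : Sum.inl (P.left e) ∈ L <;> by_cases hr : Sum.inr (P.right e) ∈ L <;>
      simp [hl, hr, hpot, hhead]

end Sign

end IsRotation

end

/-! ### Shifts, persistence of rotations, and exchange of steps on paths. -/

section

variable {F W E : Type*} [Fintype E] {P : MixedProblem F W E} {v : F ⊕ W} {x y : E → ℝ} {n : ℕ}
  {L L' : Set (F ⊕ W)} [Fintype F] [Fintype W] {ρ ρ' : E → ℤ} {c c' : ℝ}

/-! ### Rotational shifts -/

omit [Fintype E] in
lemma shift_shift (x : E → ℝ) (c c' : ℝ) (ρ : E → ℤ) :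
    shift (shift x c ρ) c' ρ = shift x (c + c') ρ := by
  funext e; simp only [shift]; ring

omit [Fintype E] in
lemma shift_comm (x : E → ℝ) (c c' : ℝ) (ρ ρ' : E → ℤ) :
    shift (shift x c ρ) c' ρ' = shift (shift x c' ρ') c ρ := by
  funext e; simp only [shift]; ring

namespace IsRotation

/-- Admissibility leaves two cases at a worker: the critical tie stays and its head can only grow,
or the tie is emptied and the new critical tie is strictly better. -/
lemma tail_shift_subset (h : P.IsRotation x L ρ) (hx : P.Stable x) (hc : P.Admissible x ρ c)
    (w : W) : P.tail (shift x c ρ) (Sum.inr w) ⊆ P.tail x (Sum.inr w) := by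
  by_cases hw : Sum.inr w ∈ L
  swap
  · rw [tail_congr fun e he => h.shift_eq_of_notMem hx.1 hw he x c]
  have hreg := h.1.1.regular hw
  have hfill : P.FullyFilled (shift x c ρ) (Sum.inr w) := (h.fullyFilled_shift _ _ _).2 hreg.1
  obtain ⟨n, hn⟩ := exists_isFilledRank (fun e _ => (hx.1.1 e).1) hreg.1
  obtain ⟨m, hm⟩ := exists_isFilledRank (fun e _ => (hc.2.1 e).1) hfill
  intro e he
  rcases hc.2.2 w hreg with ⟨h1, h2⟩ | h1
  · simp only [tail, hfill, hreg.1, if_true, begEdges, h1, Finset.mem_union, Finset.mem_sdiff]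
      at he ⊢
    exact he.imp_right fun h' => ⟨h'.1, fun hh => h'.2 (h2 hh)⟩
  · have hes := (hm.mem_tail.1 he).1
    suffices n < m by
      refine hn.mem_tail.2 ⟨hes, Or.inl ?_⟩
      rcases (hm.mem_tail.1 he).2 with h' | h' <;> omega
    obtain ⟨a, ha, har, hac⟩ := hm.exists_eq_cut
    have hpos := hm.cut_pos
    -- A positive edge of a worse tie was zero under `x`, hence was raised, yet only edges of the
    -- worker's tail are raised. The old critical tie itself has been emptied.
    by_contra! hle
    rcases hle.lt_or_eq with hlt | heq
    · have h3 : 0 < ρ a := by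
        rw [← hac, shift, hn.eq_zero ha (har ▸ hlt), zero_add] at hpos
        exact_mod_cast pos_of_mul_pos_right hpos hc.1
      rw [h.pos_iff hx.1] at h3
      obtain rfl := P.mem_star_inr.1 ha
      have := (hn.mem_tail.1 (mem_candidates.1 (mem_potHead.1 h3.2).1).2.2).2
      omega
    · have := h1 a (hn.mem_critTie.2 ⟨ha, har.trans heq⟩)
      linarith

/-- After a shift, the potential head of a vertex of the component becomes its head. -/
lemma of_mem_tail_shift_left (h : P.IsRotation x L ρ) (hx : P.Stable x)
    (hc : P.Admissible x ρ c) (hc0 : 0 < c) {f : F} (hf : Sum.inl f ∈ L) {d e : E}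
    (hd : d ∈ P.potHead x f) (he : e ∈ P.tail (shift x c ρ) (Sum.inl f)) :
    P.rank (Sum.inl f) d ≤ P.rank (Sum.inl f) e ∧ e ∉ P.potHead x f := by
  have hreg := h.1.1.regular hf
  have hfill : P.FullyFilled (shift x c ρ) (Sum.inl f) := (h.fullyFilled_shift _ _ _).2 hreg.1
  obtain ⟨n, hn⟩ := exists_isFilledRank (fun e _ => (hx.1.1 e).1) hreg.1
  obtain ⟨m, hm⟩ := exists_isFilledRank (fun e _ => (hc.2.1 e).1) hfill
  have hstar : ∀ a ∈ P.potHead x f, a ∈ P.star (Sum.inl f) :=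
    fun a ha => P.mem_star_inl.2 (left_of_mem_potHead ha)
  have hpos : ∀ a ∈ P.star (Sum.inl f), a ∈ P.potHead x f ↔ 0 < ρ a := by
    intro a ha
    obtain rfl := P.mem_star_inl.1 ha
    rw [h.pos_iff hx.1, and_iff_right hf]
  have hrank : ∀ a ∈ P.potHead x f, P.rank (Sum.inl f) a = P.rank (Sum.inl f) d := by
    intro a ha
    have h1 := mem_potHead.1 ha
    have h2 := mem_potHead.1 hd
    exact le_antisymm ((P.rank_le_iff (hstar d hd) (hstar a ha)).2 (h2.2.2 a h1.1 h1.2.1))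
      ((P.rank_le_iff (hstar a ha) (hstar d hd)).2 (h1.2.2 d h2.1 h2.2.1))
  have hnt : ∀ a ∈ P.potHead x f, a ∉ P.tail x (Sum.inl f) := by
    intro a ha
    have h1 := mem_candidates.1 (mem_potHead.1 ha).1
    have h2 := (stable_iff.1 hx).2 a h1.2.1 h1.2.2
    rwa [h1.1] at h2
  -- By stability candidates lie outside the tail of their firm, so their tie is not better than the
  -- critical one.
  have hdn : P.rank (Sum.inl f) d ≤ n := by
    by_contra! hlt
    exact hnt d hd (hn.mem_tail.2 ⟨hstar d hd, Or.inl hlt⟩)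
  -- On its own and all worse ties, an edge of the potential head is maximal both for `x`, being
  -- outside the tail, and for `ρ`, by alignment.
  have hmax : ∀ a ∈ P.potHead x f, ∀ a' ∈ P.star (Sum.inl f),
      P.rank (Sum.inl f) a' ≤ P.rank (Sum.inl f) d → shift x c ρ a' ≤ shift x c ρ a := by
    intro a ha a' ha' hr
    have h1 : x a' ≤ x a := by
      rcases hdn.lt_or_eq with hlt | heq
      · rw [hn.eq_zero ha' (hr.trans_lt hlt)]
        exact (hx.1.1 a).1
      · have h2 := hn.mem_tail.not.1 (hnt a ha)
        push Not at h2
        refine le_trans ?_ ((h2 (hstar a ha)).2 ((hrank a ha).trans heq))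
        rcases (hr.trans_eq heq).lt_or_eq with hlt | heq'
        · rw [hn.eq_zero ha' hlt]; exact hn.cut_pos.le
        · exact hn.le_cut ha' heq'
    have h2 : ρ a' ≤ ρ a := by
      have hpa := (hpos a (hstar a ha)).1 ha
      by_cases h3 : 0 < ρ a'
      · refine (h.2.1.alignedF a' a ?_ h3 hpa).le
        rw [P.mem_star_inl.1 ha', left_of_mem_potHead ha]
      · omega
    have h3 : (ρ a' : ℝ) ≤ ρ a := by exact_mod_cast h2
    exact add_le_add h1 (mul_le_mul_of_nonneg_left h3 hc0.le)
  have hmd : m = P.rank (Sum.inl f) d := by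
    refine le_antisymm ?_ ?_
    · by_contra! hlt
      have h1 : (0 : ℝ) < ρ d := by exact_mod_cast (hpos d (hstar d hd)).1 hd
      have h2 := hm.eq_zero (hstar d hd) hlt
      have := (hx.1.1 d).1
      rw [shift] at h2
      nlinarith [mul_pos hc0 h1]
    · by_contra! hlt
      obtain ⟨a, ha, har, hac⟩ := hm.exists_eq_cut
      have h1 := hm.cut_pos
      rw [← hac, shift, hn.eq_zero ha (by omega), zero_add] at h1
      have h2 : 0 < ρ a := by exact_mod_cast pos_of_mul_pos_right h1 hc0.le
      have := hrank a ((hpos a ha).2 h2)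
      omega
  obtain ⟨hes, h1⟩ := hm.mem_tail.1 he
  refine ⟨by omega, fun hed => ?_⟩
  obtain ⟨a, ha, har, hac⟩ := hm.exists_eq_cut
  have := hrank e hed
  rcases h1 with h1 | h1
  · omega
  · exact h1.2.not_ge (hac ▸ hmax e hed a ha (by omega))

/-- An edge blocking after the shift was already unsaturated and in its worker's tail before it. If
its firm is in `L`, it would be a candidate at least as good as the potential head yet outside it;
otherwise it already blocked `x`. -/
lemma stable_shift (h : P.IsRotation x L ρ) (hx : P.Stable x) (hc : P.Admissible x ρ c)
    (hc0 : 0 < c) : P.Stable (shift x c ρ) := by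
  refine stable_iff.2 ⟨h.fullyStationary_shift hx.1 hc.2.1, fun e hb hr hl => ?_⟩
  have hr' := h.tail_shift_subset hx hc _ hr
  have hxb : x e < P.b e := by
    by_contra! hxb
    have h1 : ρ e < 0 := by
      by_contra! h0
      have : (0 : ℝ) ≤ ρ e := by exact_mod_cast h0
      rw [shift] at hb
      nlinarith [mul_nonneg hc0.le this]
    exact disjoint_head_tail (fun e _ => (hx.1.1 e).1) ((h.neg_iff hx.1).1 h1).2 hr'
  by_cases hf : Sum.inl (P.left e) ∈ L
  · obtain ⟨_, ha⟩ := h.1.1.exists_arc_out hf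
    obtain ⟨d, hd⟩ : ∃ d, d ∈ P.potHead x (P.left e) := by
      generalize hu : Sum.inl (P.left e) = u at ha
      cases ha with
      | toW d hd => exact ⟨d, (Sum.inl_injective hu).symm ▸ hd.2⟩
      | toF d hd => cases hu
    obtain ⟨h1, h2⟩ := h.of_mem_tail_shift_left hx hc hc0 hf hd hl
    refine h2 (mem_potHead.2 ⟨mem_candidates.2 ⟨rfl, hxb, hr'⟩, fun a ha hge => ?_,
      fun a ha hna => ?_⟩)
    all_goals
      have hds : d ∈ P.star (Sum.inl (P.left e)) := P.mem_star_inl.2 (left_of_mem_potHead hd)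
      have hes := P.mem_star_left e
      have hd' := mem_potHead.1 hd
    · refine hd'.2.1 a ha ((P.rank_le_iff ha hds).1 (h1.trans ?_))
      exact (P.rank_le_iff ha hes).2 hge
    · have has : a ∈ P.star (Sum.inl (P.left e)) := P.mem_star_inl.2 (mem_candidates.1 ha).1
      exact (P.rank_le_iff hes has).1
        (((P.rank_le_iff hds has).2 (hd'.2.2 a ha hna)).trans h1)
  · rw [tail_congr fun e he => h.shift_eq_of_notMem hx.1 hf he x c] at hl
    exact (stable_iff.1 hx).2 e hxb hr' hl

lemma exists_pos (h : P.IsRotation x L ρ) : ∃ e, 0 < ρ e := by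
  by_contra! hn
  refine h.2.1.ne_zero (funext fun e => ?_)
  exact (Finset.sum_eq_zero_iff_of_nonpos fun e _ => hn e).1 (h.2.1.circulation _) e
    (P.mem_star_left e)

/-- The shift is stable and raises an edge in the tail of a worker, who therefore does not prefer
`x` to it. -/
lemma not_isXmax (h : P.IsRotation x L ρ) (hc : P.Admissible x ρ c) (hc0 : 0 < c) :
    ¬ P.IsXmax x := by
  intro hx
  obtain ⟨e, he⟩ := h.exists_pos
  have h1 := (h.pos_iff hx.1.1).1 he
  have hw := h.1.right_mem hx.1.1 h1.1 h1.2
  obtain ⟨n, hn⟩ := exists_isFilledRank (fun e _ => (hx.1.1.1 e).1) (h.1.1.regular hw).1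
  refine hn.not_prefAt (mem_candidates.1 (mem_potHead.1 h1.2).1).2.2 (y := shift x c ρ) ?_
    (hx.2 _ (h.stable_shift hx.1 hc hc0) _)
  have : (0 : ℝ) < ρ e := by exact_mod_cast he
  simp only [shift]
  linarith [mul_pos hc0 this]

/-! ### Persistence of rotations -/

lemma potHead_nonempty (h : P.IsRotation x L ρ) {f : F} (hf : Sum.inl f ∈ L) :
    (P.potHead x f).Nonempty := by
  have hr := h.1.1.regular hf
  rw [Finset.nonempty_iff_ne_empty]
  exact fun h0 => hr.2 (.empty f hr.1 h0)

/-- Admissibility only depends on the component of the rotation. -/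
lemma admissible_iff (h : P.IsRotation x L ρ) (hx : P.FullyStationary x) :
    P.Admissible x ρ c ↔ 0 ≤ c ∧ (∀ e, ρ e ≠ 0 → 0 ≤ shift x c ρ e ∧ shift x c ρ e ≤ P.b e) ∧
      ∀ w : W, Sum.inr w ∈ L →
        (P.critTie (Sum.inr w) (shift x c ρ) = P.critTie (Sum.inr w) x ∧
          P.head x (Sum.inr w) ⊆ P.head (shift x c ρ) (Sum.inr w)) ∨
        ∀ e ∈ P.critTie (Sum.inr w) x, shift x c ρ e = 0 := by
  refine and_congr_right fun _ => and_congr ?_ ?_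
  · refine forall_congr' fun e => ⟨fun h _ => h, fun h => ?_⟩
    by_cases h0 : ρ e = 0
    · simpa [shift, h0] using hx.1 e
    · exact h h0
  · refine forall_congr' fun w => ⟨fun h' hw => h' (h.1.1.regular hw), fun h' _ => ?_⟩
    by_cases hw : Sum.inr w ∈ L
    · exact h' hw
    · have hs : ∀ e ∈ P.star (Sum.inr w), shift x c ρ e = x e :=
        fun e he => h.shift_eq_of_notMem hx hw he x c
      exact Or.inl ⟨critTie_congr hs, (head_congr hs).symm.subset⟩

/-- A rotation persists, with the same admissible weights, after a shift along another one. -/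
lemma persists_of_ne (h : P.IsRotation x L ρ) (h' : P.IsRotation x L' ρ') (hne : L' ≠ L)
    (hx : P.Stable x) (hc' : P.Admissible x ρ' c') :
    P.IsRotation (shift x c' ρ') L ρ ∧
      ∀ c, P.Admissible (shift x c' ρ') ρ c ↔ P.Admissible x ρ c := by
  have hdisj : ∀ v ∈ L, v ∉ L' := fun v hv hv' => hne (h'.1.1.eq_of_mem h.1.1 hv' hv)
  have heq : ∀ v ∈ L, ∀ e ∈ P.star v, shift x c' ρ' e = x e :=
    fun v hv e he => h'.shift_eq_of_notMem hx.1 (hdisj v hv) he x c'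
  have hy := h'.fullyStationary_shift hx.1 hc'.2.1
  have hrot : P.IsRotation (shift x c' ρ') L ρ := by
    refine h.transfer hx.1 hy (fun v => h'.fullyFilled_shift v x c')
      (fun w hw => head_congr (heq _ hw)) fun f hf => ?_
    refine potHead_eq (fun e he => ?_) (fun e he => ?_) (h.potHead_nonempty hf) fun e _ => ?_
    · obtain ⟨h1, h2, h3⟩ := mem_candidates.1 he
      rw [heq _ hf e (P.mem_star_inl.2 h1)] at h2
      exact mem_candidates.2 ⟨h1, h2, h'.tail_shift_subset hx hc' _ h3⟩
    · obtain ⟨h1, h2, h3⟩ := mem_candidates.1 (mem_potHead.1 he).1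
      refine mem_candidates.2 ⟨h1, ?_, ?_⟩
      · rwa [heq _ hf e (P.mem_star_inl.2 h1)]
      · rwa [tail_congr (heq _ (h.1.right_mem hx.1 hf he))]
    · refine forall₂_congr fun a ha => ?_
      rw [heq _ hf a ha, h'.fullyFilled_shift]
  refine ⟨hrot, fun c => ?_⟩
  rw [hrot.admissible_iff hy, h.admissible_iff hx.1]
  have hsh : ∀ v ∈ L, ∀ e ∈ P.star v, shift (shift x c' ρ') c ρ e = shift x c ρ e := by
    intro v hv e he
    rw [shift, heq v hv e he, shift]
  refine and_congr_right fun _ => and_congr ?_ ?_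
  · refine forall₂_congr fun e h0 => ?_
    have hl : Sum.inl (P.left e) ∈ L := by
      by_contra hl
      exact h0 (h.eq_zero_of_notMem hx.1 hl (P.mem_star_left e))
    rw [hsh _ hl e (P.mem_star_left e)]
  · refine forall₂_congr fun w hw => ?_
    rw [critTie_congr (hsh _ hw), critTie_congr (heq _ hw), head_congr (hsh _ hw),
      head_congr (heq _ hw)]
    refine or_congr_right (forall₂_congr fun e he => ?_)
    rw [hsh _ hw e (Finset.mem_filter.1 he).1]

/-- A rotation persists after a shift with a weight that is not maximal. -/
lemma persists_of_lt (h : P.IsRotation x L ρ) (hx : P.Stable x) (hc : P.Admissible x ρ c)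
    (hc' : P.Admissible x ρ c') (hlt : c < c') :
    P.IsRotation (shift x c ρ) L ρ ∧ P.Admissible (shift x c ρ) ρ (c' - c) := by
  have hy := h.fullyStationary_shift hx.1 hc.2.1
  have hadd : shift (shift x c ρ) (c' - c) ρ = shift x c' ρ := by
    rw [shift_shift, add_sub_cancel]
  have hadd' : ∀ e, shift x c' ρ e = shift x c ρ e + (c' - c) * ρ e := fun e => by
    rw [← hadd]; rfl
  have hfull : ∀ w, Sum.inr w ∈ L → P.FullyFilled x (Sum.inr w) := fun w hw =>
    (h.1.1.regular hw).1
  -- The critical tie is not emptied at weight `c`, since its head edges would be negative at `c'`.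
  have hmain : ∀ w, Sum.inr w ∈ L →
      P.critTie (Sum.inr w) (shift x c ρ) = P.critTie (Sum.inr w) x ∧
        P.head (shift x c ρ) (Sum.inr w) = P.head x (Sum.inr w) := by
    intro w hw
    obtain ⟨n, hn⟩ := exists_isFilledRank (fun e _ => (hx.1.1 e).1) (hfull w hw)
    obtain ⟨m, hm⟩ := exists_isFilledRank (fun e _ => (hc.2.1 e).1)
      ((h.fullyFilled_shift _ _ _).2 (hfull w hw))
    obtain ⟨k, hk⟩ := exists_isFilledRank (fun e _ => (hc'.2.1 e).1)
      ((h.fullyFilled_shift _ _ _).2 (hfull w hw))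
    obtain ⟨a, ha⟩ := hn.head_nonempty
    obtain ⟨has, har, hac⟩ := hn.mem_head.1 ha
    have hneg : ρ a < 0 := by
      refine (h.neg_iff hx.1).2 ?_
      rw [right_of_mem_head ha]
      exact ⟨hw, ha⟩
    have hneg' : (ρ a : ℝ) < 0 := by exact_mod_cast hneg
    have hcrit : P.critTie (Sum.inr w) (shift x c ρ) = P.critTie (Sum.inr w) x ∧
        P.head x (Sum.inr w) ⊆ P.head (shift x c ρ) (Sum.inr w) := by
      refine (hc.2.2 w (h.1.1.regular hw)).resolve_right fun hz => ?_
      have h1 := hz a (hn.mem_critTie.2 ⟨has, har⟩)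
      have h2 := (hc'.2.1 a).1
      rw [hadd', h1] at h2
      nlinarith
    -- An edge that catches up with the head edge `a` at weight `c` has a larger slope and would
    -- overtake it at `c'`, against admissibility of `c'`.
    refine ⟨hcrit.1, hcrit.2.antisymm' fun e he => ?_⟩
    have hec := head_subset_critTie he
    rw [hcrit.1] at hec
    obtain ⟨hes, her⟩ := hn.mem_critTie.1 hec
    by_contra hnot
    have hxlt : x e < x a := by
      rw [hac]
      exact (hn.le_cut hes her).lt_of_ne fun h' => hnot (hn.mem_head.2 ⟨hes, her, h'⟩)
    have h1 : shift x c ρ e = shift x c ρ a := by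
      rw [(hm.mem_head.1 he).2.2, (hm.mem_head.1 (hcrit.2 ha)).2.2]
    have h2 : shift x c' ρ e ≤ shift x c' ρ a := by
      rcases hc'.2.2 w (h.1.1.regular hw) with ⟨h3, h4⟩ | h3
      · rw [← h3] at hec
        have := hk.mem_critTie.1 hec
        rw [(hk.mem_head.1 (h4 ha)).2.2]
        exact hk.le_cut this.1 this.2
      · rw [h3 e hec, h3 a (hn.mem_critTie.2 ⟨has, har⟩)]
    rw [hadd', hadd', h1] at h2
    have h3 : (ρ e : ℝ) ≤ ρ a := le_of_mul_le_mul_left (by linarith) (sub_pos.2 hlt)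
    have h4 := mul_le_mul_of_nonneg_left h3 hc.1
    simp only [shift] at h1
    linarith
  have htail : ∀ w, P.tail (shift x c ρ) (Sum.inr w) = P.tail x (Sum.inr w) := by
    intro w
    by_cases hw : Sum.inr w ∈ L
    · simp only [tail, begEdges, h.fullyFilled_shift, hmain w hw]
    · exact tail_congr fun e he => h.shift_eq_of_notMem hx.1 hw he x c
  have hb : ∀ e, e ∈ P.tail x (Sum.inr (P.right e)) → shift x c ρ e < P.b e → x e < P.b e := by
    intro e he hb
    by_contra! hxb
    have h1 : ρ e < 0 := by
      by_contra! h0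
      have : (0 : ℝ) ≤ ρ e := by exact_mod_cast h0
      rw [shift] at hb
      nlinarith [mul_nonneg hc.1 this]
    exact disjoint_head_tail (fun e _ => (hx.1.1 e).1) ((h.neg_iff hx.1).1 h1).2 he
  -- A raised edge saturated at weight `c` would exceed its capacity at `c'`.
  have hb' : ∀ e, x e < P.b e → shift x c ρ e < P.b e := by
    intro e he
    by_cases h0 : 0 < ρ e
    · have h1 : (0 : ℝ) < ρ e := by exact_mod_cast h0
      have h2 := (hc'.2.1 e).2
      rw [hadd'] at h2
      nlinarith [mul_pos (sub_pos.2 hlt) h1]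
    · have h1 : (ρ e : ℝ) ≤ 0 := by exact_mod_cast not_lt.1 h0
      simp only [shift]
      nlinarith [mul_nonneg hc.1 (neg_nonneg.2 h1)]
  have hrot : P.IsRotation (shift x c ρ) L ρ := by
    refine h.transfer hx.1 hy (fun v => h.fullyFilled_shift v x c)
      (fun w hw => (hmain w hw).2) fun f hf => ?_
    refine potHead_eq (fun e he => ?_) (fun e he => ?_) (h.potHead_nonempty hf) fun e _ => ?_
    · obtain ⟨h1, h2, h3⟩ := mem_candidates.1 he
      rw [htail] at h3
      exact mem_candidates.2 ⟨h1, hb e h3 h2, h3⟩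
    · obtain ⟨h1, h2, h3⟩ := mem_candidates.1 (mem_potHead.1 he).1
      exact mem_candidates.2 ⟨h1, hb' e h2, by rwa [htail]⟩
    -- Where `ρ` vanishes nothing changes; elsewhere the worker is in `L`, hence fully filled, and
    -- saturation is irrelevant.
    · refine forall₃_congr fun a ha _ => ?_
      rw [h.fullyFilled_shift]
      refine ⟨fun h' hxa => h' (hb' a hxa), fun h' hxa => ?_⟩
      by_cases h0 : ρ a = 0
      · exact h' (by simpa [shift, h0] using hxa)
      · refine hfull _ ?_
        by_contra hr
        exact h0 (h.eq_zero_of_notMem hx.1 hr (P.mem_star_right a))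
  refine ⟨hrot, (hrot.admissible_iff hy).2 ⟨(sub_pos.2 hlt).le, ?_, fun w hw => ?_⟩⟩
  · rw [hadd]
    exact fun e _ => hc'.2.1 e
  · rw [hadd, (hmain w hw).1, (hmain w hw).2]
    exact hc'.2.2 w (h.1.1.regular hw)

end IsRotation

/-! ### Paths of rotational shifts -/

/-- `l` is the list of rotations and weights along a sequence of shifts from `x` to `y`. -/
inductive Path (P : MixedProblem F W E) : (E → ℝ) → List (ℝ × (E → ℤ)) → (E → ℝ) → Prop
  | nil (x : E → ℝ) : Path P x [] x
  | cons {x y : E → ℝ} {L : Set (F ⊕ W)} {c : ℝ} {ρ : E → ℤ} {l : List (ℝ × (E → ℤ))} :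
      P.IsRotation x L ρ → 0 < c → P.Admissible x ρ c →
      Path P (shift x c ρ) l y → Path P x ((c, ρ) :: l) y

/-- A path of shifts with maximal weights. -/
inductive MaxPath (P : MixedProblem F W E) : (E → ℝ) → List (ℝ × (E → ℤ)) → (E → ℝ) → Prop
  | nil (x : E → ℝ) : MaxPath P x [] x
  | cons {x y : E → ℝ} {L : Set (F ⊕ W)} {c : ℝ} {ρ : E → ℤ} {l : List (ℝ × (E → ℤ))} :
      P.IsRotation x L ρ → 0 < c → P.IsMaxWeight x ρ c →
      MaxPath P (shift x c ρ) l y → MaxPath P x ((c, ρ) :: l) y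

variable {l l' : List (ℝ × (E → ℤ))}

/-- A rotation with a positive admissible weight is used on every path to the maximal stable
assignment. -/
lemma Path.exists_mem (hp : P.Path x l y) (hx : P.Stable x) (hy : P.IsXmax y)
    (h : P.IsRotation x L ρ) (hc0 : 0 < c) (hc : P.Admissible x ρ c) :
    ρ ∈ l.map Prod.snd := by
  induction hp with
  | nil x => exact absurd hy (h.not_isXmax hc hc0)
  | @cons x y L' c' ρ' l h' hc0' hc' _ ih =>
    by_cases hne : L' = L
    · subst hne
      simp [h.unique h']
    · obtain ⟨h1, h2⟩ := h.persists_of_ne h' hne hx hc'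
      exact List.mem_cons_of_mem _
        (ih (h'.stable_shift hx hc' hc0') hy h1 ((h2 c).2 hc))

/-- A step of smaller weight would leave its rotation applicable, which would then have to occur
again later. -/
lemma Path.maxPath (hp : P.Path x l y) (hx : P.Stable x) (hy : P.IsXmax y)
    (hl : (l.map Prod.snd).Nodup) : P.MaxPath x l y := by
  induction hp with
  | nil x => exact .nil x
  | @cons x y L c ρ l h hc0 hc hp ih =>
    rw [List.map_cons, List.nodup_cons] at hl
    refine .cons h hc0 ⟨hc, fun c' hc' => ?_⟩ (ih (h.stable_shift hx hc hc0) hy hl.2)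
    by_contra! hlt
    obtain ⟨h1, h2⟩ := h.persists_of_lt hx hc hc' hlt
    exact hl.1 (hp.exists_mem (h.stable_shift hx hc hc0) hy h1 (sub_pos.2 hlt) h2)

/-- An applicable rotation can be moved to the front of a path. -/
lemma MaxPath.exchange (hp : P.MaxPath x l y) (hx : P.Stable x) (hy : P.IsXmax y)
    (h : P.IsRotation x L ρ) (hc0 : 0 < c) (hc : P.IsMaxWeight x ρ c) :
    ∃ l₁ l₂, l = l₁ ++ (c, ρ) :: l₂ ∧ P.MaxPath (shift x c ρ) (l₁ ++ l₂) y := by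
  induction hp with
  | nil x => exact absurd hy (h.not_isXmax hc.1 hc0)
  | @cons x y L' c' ρ' l h' hc0' hc' hp ih =>
    by_cases hne : L' = L
    · subst hne
      obtain rfl := h.unique h'
      obtain rfl := hc.unique hc'
      exact ⟨[], l, rfl, hp⟩
    · obtain ⟨h1, h2⟩ := h.persists_of_ne h' hne hx hc'.1
      -- Persistence is needed in both directions: `ρ` must survive the first step for the
      -- induction, and the first step must survive `ρ` to be replayed after it.
      obtain ⟨h3, h4⟩ := h'.persists_of_ne h (Ne.symm hne) hx hc.1
      obtain ⟨l₁, l₂, rfl, hp'⟩ := ih (h'.stable_shift hx hc'.1 hc0') hy h1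
        (by simpa only [IsMaxWeight, h2] using hc)
      rw [shift_comm] at hp'
      exact ⟨(c', ρ') :: l₁, l₂, rfl,
        .cons h3 hc0' (by simpa only [IsMaxWeight, h4] using hc') hp'⟩

/-- The first step of one path is moved to the front of the other; removing it from both leaves two
shorter paths with the same ends. -/
lemma MaxPath.perm (hp : P.MaxPath x l y) (hp' : P.MaxPath x l' y) (hx : P.Stable x)
    (hy : P.IsXmax y) : l.Perm l' := by
  induction hp generalizing l' with
  | nil x =>
    cases hp' with
    | nil => rfl
    | cons h hc0 hc _ => exact absurd hy (h.not_isXmax hc.1 hc0)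
  | cons h hc0 hc _ ih =>
    obtain ⟨l₁, l₂, rfl, hq⟩ := hp'.exchange hx hy h hc0 hc
    exact ((ih hq (h.stable_shift hx hc.1 hc0) hy).cons _).trans List.perm_middle.symm

/-! ### Routes -/

namespace ShiftSequence

variable (T : P.ShiftSequence)

/-- The list of steps of a shift sequence from its `k`-th assignment on. -/
lemma exists_path (k : ℕ) (hk : k ≤ T.N) :
    P.Path (T.x ⟨T.N - k, by omega⟩)
      ((List.ofFn fun i => (T.weight i, T.rot i)).drop (T.N - k)) (T.x (Fin.last T.N)) := by
  -- Here `k` counts the steps that remain, so the path is built from its end.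
  induction k with
  | zero =>
    rw [List.drop_eq_nil_of_le (by simp)]
    exact .nil _
  | succ k ih =>
    have hlt : T.N - (k + 1) < T.N := by omega
    have hs : T.N - (k + 1) + 1 = T.N - k := by omega
    rw [List.drop_eq_getElem_cons (by simpa using hlt), List.getElem_ofFn]
    refine .cons (T.isRotation ⟨_, hlt⟩) (T.weight_pos _) (T.admissible ⟨_, hlt⟩) ?_
    have h1 := T.step ⟨_, hlt⟩
    have h2 : (Fin.succ ⟨_, hlt⟩ : Fin (T.N + 1)) = ⟨T.N - k, by omega⟩ := Fin.ext hs
    rw [h2] at h1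
    have := ih (by omega)
    rw [h1] at this
    rw [hs]
    exact this

variable {T}

lemma IsRoute.maxPath (hT : T.IsRoute) : P.MaxPath (T.x 0)
    (List.ofFn fun i => (T.weight i, T.rot i)) (T.x (Fin.last T.N)) := by
  have h := T.exists_path T.N le_rfl
  simp only [Nat.sub_self, List.drop_zero] at h
  refine h.maxPath (T.stable 0) hT.2.2 ?_
  rw [List.map_ofFn, List.nodup_ofFn]
  exact hT.1

lemma IsRoute.isMaxWeight (hT : T.IsRoute) (i : Fin T.N) :
    P.IsMaxWeight (T.x i.castSucc) (T.rot i) (T.weight i) := by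
  refine ⟨T.admissible i, fun c hc => ?_⟩
  by_contra! hlt
  have hs := T.stable i.succ
  obtain ⟨h1, h2⟩ := (T.isRotation i).persists_of_lt (T.stable _) (T.admissible i) hc hlt
  rw [← T.step] at h1 h2
  -- The part of the route after step `i`; it would have to use `T.rot i` again, against
  -- injectivity.
  have hp := T.exists_path (T.N - (i + 1)) (by omega)
  have hi : T.N - (T.N - (i + 1)) = i + 1 := by omega
  have hi' : (⟨T.N - (T.N - (i + 1)), by omega⟩ : Fin (T.N + 1)) = i.succ := Fin.ext hi
  rw [hi', hi] at hp
  have hmem := hp.exists_mem hs hT.2.2 h1 (sub_pos.2 hlt) h2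
  rw [List.map_drop, List.map_ofFn, List.mem_drop_iff_getElem] at hmem
  obtain ⟨j, hj, hje⟩ := hmem
  simp only [List.getElem_ofFn, Function.comp_apply] at hje
  have := congrArg Fin.val (hT.1 hje)
  simp at this
  omega

lemma IsRoute.pairs_eq {T' : P.ShiftSequence} (hT : T.IsRoute) (hT' : T'.IsRoute) :
    T.pairs = T'.pairs := by
  have h1 := hT.maxPath
  have h2 := hT'.maxPath
  rw [hT'.2.1.eq hT.2.1, hT'.2.2.eq hT.2.2] at h2
  have hperm := h1.perm h2 (T.stable 0) hT.2.2
  ext p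
  have h3 := hperm.mem_iff (a := p)
  rw [List.mem_ofFn, List.mem_ofFn] at h3
  exact h3

end ShiftSequence

end

end

end MixedProblem

theorem mainTheorem5 {F W E : Type*} [Fintype F] [Fintype W] [Fintype E]
    (P : MixedProblem F W E) :
    (∀ T T' : P.ShiftSequence, T.IsRoute → T'.IsRoute → T.pairs = T'.pairs) ∧
    ∃ (R : Set (E → ℤ)) (τ : (E → ℤ) → ℝ), ∀ T : P.ShiftSequence, T.IsRoute →
      T.rotations = R ∧
      T.pairs = {p | p.2 ∈ R ∧ p.1 = τ p.2} ∧
      ∀ i, P.IsMaxWeight (T.x i.castSucc) (T.rot i) (τ (T.rot i)) := by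
  classical
  refine ⟨fun T T' hT hT' => hT.pairs_eq hT', ?_⟩
  by_cases hex : ∃ T₀ : P.ShiftSequence, T₀.IsRoute
  swap
  -- Without routes any choice will do.
  · exact ⟨∅, 0, fun T hT => absurd ⟨T, hT⟩ hex⟩
  obtain ⟨T₀, hT₀⟩ := hex
  -- The weights of one fixed route define `τ`, with value `0` off its rotations; on them it is the
  -- intended weight because `T₀.rot` is injective.
  refine ⟨T₀.rotations, Function.extend T₀.rot T₀.weight 0, fun T hT => ?_⟩
  have hrot : ∀ S : P.ShiftSequence, S.rotations = Prod.snd '' S.pairs := fun S =>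
    Set.range_comp Prod.snd fun i => (S.weight i, S.rot i)
  have hτ : ∀ i, Function.extend T₀.rot T₀.weight 0 (T₀.rot i) = T₀.weight i :=
    fun i => hT₀.1.extend_apply _ _ i
  have hpairs : T.pairs = T₀.pairs := hT.pairs_eq hT₀
  refine ⟨by rw [hrot, hrot, hpairs], ?_, fun i => ?_⟩
  · rw [hpairs]
    ext ⟨c, ρ⟩
    constructor
    · rintro ⟨i, hi⟩
      obtain ⟨rfl, rfl⟩ := Prod.mk.inj hi
      exact ⟨⟨i, rfl⟩, (hτ i).symm⟩
    · rintro ⟨⟨i, rfl⟩, h⟩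
      exact ⟨i, by rw [show c = T₀.weight i from h.trans (hτ i)]⟩
  · have hmem : (T.weight i, T.rot i) ∈ T₀.pairs := hpairs ▸ ⟨i, rfl⟩
    obtain ⟨j, hj⟩ := hmem
    obtain ⟨h1, h2⟩ := Prod.mk.inj hj
    rw [← h2, hτ, h1, h2]
    exact hT.isMaxWeight i
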